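/- Let $V:\mathbb{R}^3\to\mathbb{R}$ be $C^\infty$ and spherically symmetric, and suppose that for some $Z>0$, $\lim_{|x|\to\infty}|x|V(x)=-Z$. Let $H^1_{\mathrm{rad}}(\mathbb{R}^3)$ be the space of radial real-valued functions in $L^2(\mathbb{R}^3)$ whose weak gradient is in $L^2$, and let $L=-\Delta+V$, interpreted as the operator with form domain $H^1_{\mathrm{rad}}(\mathbb{R}^3)$. That is, $(-E,\psi)$ is an eigenpair of $L$ if $0\neq\psi\in H^1_{\mathrm{rad}}(\mathbb{R}^3)$ and $$\int\nabla\psi\cdot\nabla\eta\,dx+\int V\psi\eta\,dx=-E\int\psi\eta\,dx\qquad\text{for all }\eta\in H^1_{\mathrm{rad}}(\mathbb{R}^3).$$ Then every eigenfunction $\psi$ agrees almost everywhere with a (necessarily unique) continuous function, with which we identify it, and we let its number of zeros be the number, in $\{0,1,2,\dots\}\cup\{\infty\}$, of radii $r\ge 0$ such that $\psi$ vanishes at some point with $|x|=r$. If $(-E,\psi)$ is an eigenpair with $-E<0$, then the number of zeros of $\psi$ is finite. Moreover, if $(-E_m,\psi_m)$ and $(-E_n,\psi_n)$ are eigenpairs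 of $L$ with numbers of zeros $N_m$ and $N_n$, then $$-E_m>-E_n\quad\Longrightarrow\quad N_m\ge N_n+1 .$$ (Here $\infty\ge\infty+1$ by convention; by the finiteness just stated, this is the strict inequality $N_m>N_n$ whenever $-E_n<0$.) -/

import Mathlib

open MeasureTheory Filter Topology
open scoped ContDiff

/-- Three-dimensional Euclidean space. -/
abbrev E3 : Type := EuclideanSpace ℝ (Fin 3)

/-- `G` is the weak gradient of `u` on `ℝ³`: both are locally integrable and
`∫ u ∇η = - ∫ η G` for every smooth compactly supported test function `η`. -/
def IsWeakGradient (u : E3 → ℝ) (G : E3 → E3) : Prop :=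
  LocallyIntegrable u volume ∧ LocallyIntegrable G volume ∧
    ∀ η : E3 → ℝ, ContDiff ℝ ∞ η → HasCompactSupport η →
      ∫ x, u x • gradient η x = - ∫ x, η x • G x

/-- `u` is (almost everywhere) a function of `|x|` only. -/
def IsRadialAE (u : E3 → ℝ) : Prop :=
  ∃ f : ℝ → ℝ, Measurable f ∧ u =ᵐ[volume] fun x => f ‖x‖

/-- `u` belongs to `H¹_rad(ℝ³)`, the space of radial functions in `L²` that have a weak gradient
in `L²`, and `G` is its weak gradient. -/
structure MemH1Rad (u : E3 → ℝ) (G : E3 → E3) : Prop where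
  radial : IsRadialAE u
  memLp : MemLp u 2 volume
  memLp_grad : MemLp G 2 volume
  weakGrad : IsWeakGradient u G

/-- `(lam, ψ)` is an eigenpair of `-Δ + V`, interpreted as the operator with form domain
`H¹_rad(ℝ³)`: `ψ ∈ H¹_rad(ℝ³)` is not zero (as an element of `L²`), and
`∫ ∇ψ · ∇η + ∫ V ψ η = lam ∫ ψ η` for all `η ∈ H¹_rad(ℝ³)`. -/
def IsRadialEigenpair (V : E3 → ℝ) (lam : ℝ) (ψ : E3 → ℝ) : Prop :=
  ¬ (ψ =ᵐ[volume] 0) ∧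
    ∃ G : E3 → E3, MemH1Rad ψ G ∧
      ∀ (η : E3 → ℝ) (K : E3 → E3), MemH1Rad η K →
        (∫ x, inner ℝ (G x) (K x)) + (∫ x, V x * ψ x * η x) = lam * ∫ x, ψ x * η x

/-- The zeros of a radial function, in the radial coordinate: the set of all radii `|x|` of points
`x` at which the function vanishes. -/
def zeroRadii (ψ : E3 → ℝ) : Set ℝ :=
  (fun x : E3 => ‖x‖) '' {x | ψ x = 0}

/-- The number of zeros of a radial function in the radial coordinate, in `{0, 1, 2, …, ∞}`. -/
noncomputable def numZeros (ψ : E3 → ℝ) : ℕ∞ :=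
  (zeroRadii ψ).encard

/-! For a radial eigenfunction `ψ = f(|x|)` the function `w(r) = r f(r)` solves `w'' = q w` with `q
= V - lam`, `w(0) = 0`, and `w` is square integrable on the half-line because the Jacobian `r²` is
absorbed. The profile of `V` extends evenly to all of ℝ, so `0` is an ordinary point of the
equation. Regularity (`exists_isSolution_of_weak`, `IsRadialEigenpair.exists_isSolution`) gives a
classical solution `W`, and `W(r)/r`, with value `W'(0)` at `0`, is the continuous representative of
`ψ`. Uniqueness forces `W'(0) ≠ 0`, so the zero radii of `ψ` are exactly the positive zeros of `W`.

The rest is Sturm theory. Raising the eigenvalue lowers `q`. By monotonicity of the Wronskian, the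
solution with lower `q` vanishes strictly between two zeros of the other
(`IsSolution.exists_zero_Ioo`), and also beyond each such zero (`IsSolution.exists_zero_Ioi`), where
square integrability replaces the second zero. The common zero at `0` is not counted by `numZeros`
but starts an interval, which yields the extra zero (`encard_add_one_le_of_interlacing`).

Finiteness for `-E < 0`: since `V → 0`, `q` is eventually positive, where a solution has at most one
zero; on a compact interval zeros cannot accumulate. -/

/-! ### Solutions of the one-dimensional equation -/

/-- `w` solves `w'' = q w` on the real line, with derivative `w'`. -/
structure IsSolution (q w w' : ℝ → ℝ) : Prop where
  hasDerivAt : ∀ r, HasDerivAt w (w' r) r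
  hasDerivAt' : ∀ r, HasDerivAt w' (q r * w r) r

namespace IsSolution

variable {q w w' : ℝ → ℝ}

theorem continuous (h : IsSolution q w w') : Continuous w :=
  continuous_iff_continuousAt.2 fun r => (h.hasDerivAt r).continuousAt

theorem continuous' (h : IsSolution q w w') : Continuous w' :=
  continuous_iff_continuousAt.2 fun r => (h.hasDerivAt' r).continuousAt

theorem neg (h : IsSolution q w w') : IsSolution q (fun r => -w r) (fun r => -w' r) where
  hasDerivAt r := (h.hasDerivAt r).neg
  hasDerivAt' r := (h.hasDerivAt' r).neg.congr_deriv (by ring)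

/-- Uniqueness for the first-order system in `(w, w')`, whose vector field is Lipschitz with
constant `max 1 (sup |q|)` on a bounded interval containing `p` and `r`. -/
theorem eq_zero (h : IsSolution q w w') (hq : Continuous q) {p : ℝ} (h0 : w p = 0)
    (h1 : w' p = 0) (r : ℝ) : w r = 0 := by
  obtain ⟨K, hK⟩ := (isCompact_Icc (a := min p r - 1) (b := max p r + 1)).exists_bound_of_continuousOn
    hq.continuousOn
  let K' : NNReal := ⟨max 1 K, le_max_of_le_left zero_le_one⟩
  have hK' : (K' : ℝ) = max 1 K := rfl
  have := ODE_solution_unique_of_mem_Ioo (E := ℝ × ℝ)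
    (v := fun t x => (x.2, q t * x.1)) (s := fun _ => Set.univ) (K := K')
    (f := fun t => (w t, w' t)) (g := fun _ => 0) (a := min p r - 1) (b := max p r + 1) (t₀ := p)
    ?_ ⟨by linarith [min_le_left p r], by linarith [le_max_left p r]⟩ ?_ ?_ ?_
  · exact congrArg Prod.fst (this (x := r)
      ⟨by linarith [min_le_right p r], by linarith [le_max_right p r]⟩)
  · intro t ht
    refine LipschitzWith.lipschitzOnWith (LipschitzWith.of_dist_le_mul fun x y => ?_)
    have hqt : |q t| ≤ K' := (hK t (Set.Ioo_subset_Icc_self ht)).trans (le_max_right _ _)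
    have h1K : (1 : ℝ) ≤ K' := le_max_left _ _
    simp only [Prod.dist_eq, Real.dist_eq]
    refine max_le ?_ ?_
    · calc |x.2 - y.2| ≤ max |x.1 - y.1| |x.2 - y.2| := le_max_right _ _
        _ ≤ _ := le_mul_of_one_le_left (by positivity) h1K
    · rw [← mul_sub, abs_mul]
      exact mul_le_mul hqt (le_max_left _ _) (abs_nonneg _) K'.2
  · exact fun t _ => ⟨(h.hasDerivAt t).prodMk (h.hasDerivAt' t), trivial⟩
  · intro t _
    refine ⟨?_, trivial⟩
    have : ((0 : ℝ × ℝ).2, q t * (0 : ℝ × ℝ).1) = 0 := by simp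
    simp only [this]
    exact hasDerivAt_const t _
  · simp [h0, h1]

end IsSolution

theorem forall_pos_or_forall_neg_of_isPreconnected {w : ℝ → ℝ} {s : Set ℝ}
    (hs : IsPreconnected s) (hw : ContinuousOn w s) (h0 : ∀ x ∈ s, w x ≠ 0) :
    (∀ x ∈ s, 0 < w x) ∨ ∀ x ∈ s, w x < 0 := by
  by_contra! hcon
  obtain ⟨⟨x, hx, hwx⟩, y, hy, hwy⟩ := hcon
  obtain ⟨z, hz, hwz⟩ := hs.intermediate_value hx hy hw ⟨hwx, hwy⟩
  exact h0 z hz hwz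

theorem HasDerivAt.nonneg_of_pos_right {w : ℝ → ℝ} {d a b : ℝ} (hd : HasDerivAt w d a)
    (hab : a < b) (h0 : w a = 0) (hpos : ∀ x ∈ Set.Ioo a b, 0 < w x) : 0 ≤ d := by
  have := (hasDerivWithinAt_iff_tendsto_slope' (by simp)).1 (hd.hasDerivWithinAt (s := Set.Ioi a))
  refine ge_of_tendsto this ?_
  filter_upwards [Ioo_mem_nhdsGT hab] with x hx
  rw [slope_def_field, h0]
  have := hpos x hx
  have := sub_pos.2 hx.1
  rw [sub_zero]
  positivity

theorem HasDerivAt.nonpos_of_pos_left {w : ℝ → ℝ} {d a b : ℝ} (hd : HasDerivAt w d b)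
    (hab : a < b) (h0 : w b = 0) (hpos : ∀ x ∈ Set.Ioo a b, 0 < w x) : d ≤ 0 := by
  have hd' : HasDerivAt (fun x => w (-x)) (-d) (-b) := by
    have := HasDerivAt.scomp (-b) (h := fun x : ℝ => -x) (h' := -1) (g₁ := w) (g₁' := d)
      (by simpa using hd) (hasDerivAt_neg (-b))
    simpa [Function.comp_def] using this
  have := hd'.nonneg_of_pos_right (b := -a) (by linarith) (by simpa using h0)
    fun x hx => hpos _ ⟨by linarith [hx.2], by linarith [hx.1]⟩
  linarith

theorem not_integrableOn_Ioi_of_le {f : ℝ → ℝ} {T δ : ℝ} (hδ : 0 < δ)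
    (h : ∀ x ∈ Set.Ioi T, δ ≤ f x) : ¬ IntegrableOn f (Set.Ioi T) := by
  intro hf
  have : IntegrableOn (fun _ : ℝ => δ) (Set.Ioi T) := by
    refine Integrable.mono' hf aestronglyMeasurable_const ?_
    filter_upwards [ae_restrict_mem measurableSet_Ioi] with x hx
    rw [Real.norm_of_nonneg hδ.le]
    exact h x hx
  rw [integrableOn_const_iff] at this
  simp [hδ.ne'] at this

/-- Integrate `(w w')' = w'² + q w²`: the term with `q` is controlled by `∫ w²`, and the boundary
term is bounded above along a sequence tending to infinity, which suffices since the integrand is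
nonnegative. -/
theorem IsSolution.integrableOn_deriv_sq {q w w' : ℝ → ℝ} (h : IsSolution q w w')
    (hq : Continuous q) {a C : ℝ} (hC : ∀ r, a ≤ r → |q r| ≤ C)
    (hw : IntegrableOn (fun r => w r ^ 2) (Set.Ioi a)) :
    IntegrableOn (fun r => w' r ^ 2) (Set.Ioi a) := by
  have hder : ∀ r, HasDerivAt (fun r => w r * w' r) (w' r ^ 2 + q r * w r ^ 2) r := fun r =>
    ((h.hasDerivAt r).mul (h.hasDerivAt' r)).congr_deriv (by ring)
  -- If `w w' > 1` on a whole half-line, then `w² - 2r` is nondecreasing there and `w²` is not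
  -- integrable.
  have hfreq : ∀ n : ℕ, ∃ b, a + n ≤ b ∧ w b * w' b ≤ 1 := by
    intro n
    by_contra! hcon
    have hmono : MonotoneOn (fun r => w r ^ 2 - 2 * r) (Set.Ici (a + n)) := by
      have hd : ∀ r, HasDerivAt (fun r => w r ^ 2 - 2 * r) (2 * (w r * w' r) - 2) r := fun r =>
        (((h.hasDerivAt r).pow 2).sub ((hasDerivAt_id r).const_mul 2)).congr_deriv (by simp; ring)
      refine monotoneOn_of_deriv_nonneg (convex_Ici _)
        (fun r _ => (hd r).continuousAt.continuousWithinAt)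
        (fun r _ => (hd r).differentiableAt.differentiableWithinAt) fun r hr => ?_
      rw [interior_Ici] at hr
      rw [(hd r).deriv]
      linarith [hcon r (le_of_lt hr)]
    refine not_integrableOn_Ioi_of_le (T := a + n + 1) one_pos (fun x hx => ?_)
      (hw.mono_set (Set.Ioi_subset_Ioi (by linarith [n.cast_nonneg (α := ℝ)])))
    have hx' : a + n + 1 < x := hx
    have := hmono (Set.self_mem_Ici) (show x ∈ Set.Ici (a + n) by simp; linarith) (by linarith)
    simp only at this
    nlinarith [sq_nonneg (w (a + n))]
  choose b hb hb1 using hfreq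
  have hcw : Continuous fun r => w r ^ 2 := h.continuous.pow 2
  have hcw' : Continuous fun r => w' r ^ 2 := h.continuous'.pow 2
  have hcq : Continuous fun r => q r * w r ^ 2 := hq.mul hcw
  have hab : ∀ n, a ≤ b n := fun n => by linarith [hb n, n.cast_nonneg (α := ℝ)]
  refine integrableOn_Ioi_of_intervalIntegral_norm_bounded (l := atTop) (b := b)
    (1 - w a * w' a + C * ∫ r in Set.Ioi a, w r ^ 2) a
    (fun n => hcw'.integrableOn_Ioc) ?_ (Eventually.of_forall fun n => ?_)
  · exact tendsto_atTop_mono hb (tendsto_atTop_add_const_left _ _ tendsto_natCast_atTop_atTop)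
  · have hI := intervalIntegral.integral_eq_sub_of_hasDerivAt (a := a) (b := b n)
      (fun r _ => hder r) ((hcw'.add hcq).intervalIntegrable _ _)
    rw [intervalIntegral.integral_add (hcw'.intervalIntegrable _ _)
      (hcq.intervalIntegrable _ _)] at hI
    have hlow : -(C * ∫ r in Set.Ioi a, w r ^ 2) ≤ ∫ r in a..b n, q r * w r ^ 2 := by
      have hC0 : 0 ≤ C := (abs_nonneg _).trans (hC a le_rfl)
      have h1 : ∫ r in a..b n, w r ^ 2 ≤ ∫ r in Set.Ioi a, w r ^ 2 := by
        rw [intervalIntegral.integral_of_le (hab n)]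
        exact setIntegral_mono_set hw (Eventually.of_forall fun r => sq_nonneg _)
          (Set.Ioc_subset_Ioi_self).eventuallyLE
      have h2 : ∫ r in a..b n, -(C * w r ^ 2) ≤ ∫ r in a..b n, q r * w r ^ 2 := by
        refine intervalIntegral.integral_mono_on (hab n)
          ((hcw.const_mul C).neg.intervalIntegrable _ _) (hcq.intervalIntegrable _ _)
          fun r hr => ?_
        have := neg_le_of_abs_le (hC r hr.1)
        nlinarith [sq_nonneg (w r)]
      rw [intervalIntegral.integral_neg, intervalIntegral.integral_const_mul] at h2
      have := mul_le_mul_of_nonneg_left h1 hC0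
      linarith
    have hn : ∫ r in a..b n, ‖w' r ^ 2‖ = ∫ r in a..b n, w' r ^ 2 := by
      refine intervalIntegral.integral_congr fun r _ => ?_
      simp
    rw [hn]
    linarith [hb1 n]

/-! ### Sturm comparison through the Wronskian -/

section Comparison

variable {q₁ q₂ u u' v v' : ℝ → ℝ}

theorem IsSolution.hasDerivAt_wronskian (hu : IsSolution q₁ u u') (hv : IsSolution q₂ v v')
    (r : ℝ) :
    HasDerivAt (fun r => u' r * v r - u r * v' r) ((q₁ r - q₂ r) * (u r * v r)) r :=
  (((hu.hasDerivAt' r).mul (hv.hasDerivAt r)).sub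
    ((hu.hasDerivAt r).mul (hv.hasDerivAt' r))).congr_deriv (by ring)

theorem IsSolution.strictMonoOn_wronskian (hu : IsSolution q₁ u u') (hv : IsSolution q₂ v v')
    (hq : ∀ r, q₂ r < q₁ r) {s : Set ℝ} (hs : Convex ℝ s)
    (hu0 : ∀ r ∈ interior s, 0 < u r) (hv0 : ∀ r ∈ interior s, 0 < v r) :
    StrictMonoOn (fun r => u' r * v r - u r * v' r) s := by
  refine strictMonoOn_of_deriv_pos hs
    (fun r _ => (hu.hasDerivAt_wronskian hv r).continuousAt.continuousWithinAt) fun r hr => ?_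
  rw [(hu.hasDerivAt_wronskian hv r).deriv]
  exact mul_pos (sub_pos.2 (hq r)) (mul_pos (hu0 r hr) (hv0 r hr))

theorem nonneg_of_pos_right {v : ℝ → ℝ} (hv : Continuous v) {a b : ℝ} (hab : a < b)
    (hpos : ∀ x ∈ Set.Ioo a b, 0 < v x) : 0 ≤ v a := by
  refine ge_of_tendsto (hv.continuousWithinAt (s := Set.Ioi a) (x := a)) ?_
  filter_upwards [Ioo_mem_nhdsGT hab] with x hx using (hpos x hx).le

theorem nonneg_of_pos_left {v : ℝ → ℝ} (hv : Continuous v) {a b : ℝ} (hab : a < b)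
    (hpos : ∀ x ∈ Set.Ioo a b, 0 < v x) : 0 ≤ v b := by
  refine ge_of_tendsto (hv.continuousWithinAt (s := Set.Iio b) (x := b)) ?_
  filter_upwards [Ioo_mem_nhdsLT hab] with x hx using (hpos x hx).le

/-- The Wronskian `u'v - uv'` is strictly increasing, yet equals `u'v ≥ 0` at `a` and `u'v ≤ 0` at
`b`. -/
theorem IsSolution.false_of_pos_Ioo (hu : IsSolution q₁ u u') (hv : IsSolution q₂ v v')
    (hq : ∀ r, q₂ r < q₁ r) {a b : ℝ} (hab : a < b) (ha : u a = 0) (hb : u b = 0)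
    (hu0 : ∀ r ∈ Set.Ioo a b, 0 < u r) (hv0 : ∀ r ∈ Set.Ioo a b, 0 < v r) : False := by
  have hW := hu.strictMonoOn_wronskian hv hq (convex_Icc a b) (by rwa [interior_Icc])
    (by rwa [interior_Icc]) (Set.left_mem_Icc.2 hab.le) (Set.right_mem_Icc.2 hab.le) hab
  simp only [ha, hb, zero_mul, sub_zero] at hW
  have h1 := mul_nonneg ((hu.hasDerivAt a).nonneg_of_pos_right hab ha hu0)
    (nonneg_of_pos_right hv.continuous hab hv0)
  have h2 := mul_nonneg (neg_nonneg.2 ((hu.hasDerivAt b).nonpos_of_pos_left hab hb hu0))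
    (nonneg_of_pos_left hv.continuous hab hv0)
  linarith

/-- The Wronskian starts nonnegative at `a` and increases strictly, so it stays above a positive
constant beyond `a + 1`. But it is dominated by `u'² + v² + u² + v'²`, hence integrable. -/
theorem IsSolution.false_of_pos_Ioi (hu : IsSolution q₁ u u') (hv : IsSolution q₂ v v')
    (hq : ∀ r, q₂ r < q₁ r) (hq₁ : Continuous q₁) (hq₂ : Continuous q₂) {a C : ℝ}
    (hC₁ : ∀ r, a ≤ r → |q₁ r| ≤ C) (hC₂ : ∀ r, a ≤ r → |q₂ r| ≤ C)
    (hiu : IntegrableOn (fun r => u r ^ 2) (Set.Ioi a))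
    (hiv : IntegrableOn (fun r => v r ^ 2) (Set.Ioi a)) (ha : u a = 0)
    (hu0 : ∀ r ∈ Set.Ioi a, 0 < u r) (hv0 : ∀ r ∈ Set.Ioi a, 0 < v r) : False := by
  have hW := hu.strictMonoOn_wronskian hv hq (convex_Ici a) (by rwa [interior_Ici])
    (by rwa [interior_Ici])
  have hlt : a < a + 1 := by linarith
  have h1 := mul_nonneg ((hu.hasDerivAt a).nonneg_of_pos_right hlt ha fun x hx => hu0 x hx.1)
    (nonneg_of_pos_right hv.continuous hlt fun x hx => hv0 x hx.1)
  have h2 := hW (Set.self_mem_Ici) (show a + 1 ∈ Set.Ici a from hlt.le) hlt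
  simp only [ha, zero_mul, sub_zero] at h2
  refine not_integrableOn_Ioi_of_le (T := a + 1) (h1.trans_lt h2)
    (f := fun r => u' r * v r - u r * v' r)
    (fun x hx => hW.monotoneOn (show a + 1 ∈ Set.Ici a from hlt.le)
      (show x ∈ Set.Ici a from hlt.le.trans (le_of_lt hx)) (le_of_lt hx)) ?_
  refine IntegrableOn.mono_set ?_ (Set.Ioi_subset_Ioi hlt.le)
  refine Integrable.mono' (((hu.integrableOn_deriv_sq hq₁ hC₁ hiu).add hiv).add
    (hiu.add (hv.integrableOn_deriv_sq hq₂ hC₂ hiv))) ?_ (Eventually.of_forall fun r => ?_)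
  · exact ((hu.continuous'.mul hv.continuous).sub
      (hu.continuous.mul hv.continuous')).aestronglyMeasurable
  · simp only [Pi.add_apply, Real.norm_eq_abs]
    rw [abs_le]
    constructor <;>
    nlinarith [sq_nonneg (u' r + v r), sq_nonneg (u' r - v r), sq_nonneg (u r + v' r),
      sq_nonneg (u r - v' r), sq_nonneg (u' r), sq_nonneg (u r), sq_nonneg (v r), sq_nonneg (v' r)]

theorem IsSolution.exists_zero_Ioo_of_ne_zero (hu : IsSolution q₁ u u')
    (hv : IsSolution q₂ v v') (hq : ∀ r, q₂ r < q₁ r) {a b : ℝ} (hab : a < b) (ha : u a = 0)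
    (hb : u b = 0) (hu0 : ∀ r ∈ Set.Ioo a b, u r ≠ 0) : ∃ c ∈ Set.Ioo a b, v c = 0 := by
  by_contra! hcon
  rcases forall_pos_or_forall_neg_of_isPreconnected isPreconnected_Ioo hu.continuous.continuousOn
    hu0 with h1 | h1 <;>
  rcases forall_pos_or_forall_neg_of_isPreconnected isPreconnected_Ioo hv.continuous.continuousOn
    hcon with h2 | h2
  · exact hu.false_of_pos_Ioo hv hq hab ha hb h1 h2
  · exact hu.false_of_pos_Ioo hv.neg hq hab ha hb h1 fun r hr => neg_pos.2 (h2 r hr)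
  · exact hu.neg.false_of_pos_Ioo hv hq hab (by simp [ha]) (by simp [hb])
      (fun r hr => neg_pos.2 (h1 r hr)) h2
  · exact hu.neg.false_of_pos_Ioo hv.neg hq hab (by simp [ha]) (by simp [hb])
      (fun r hr => neg_pos.2 (h1 r hr)) fun r hr => neg_pos.2 (h2 r hr)

/-- A solution that does not vanish identically is nonzero somewhere on every interval. -/
theorem IsSolution.exists_ne_zero_Ioo {q w w' : ℝ → ℝ} (h : IsSolution q w w')
    (hq : Continuous q) (hne : ∃ r, w r ≠ 0) {a b : ℝ} (hab : a < b) :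
    ∃ c ∈ Set.Ioo a b, w c ≠ 0 := by
  by_contra! hcon
  obtain ⟨r, hr⟩ := hne
  obtain ⟨c, hc⟩ := Set.nonempty_Ioo.2 hab
  refine hr (h.eq_zero hq (hcon c hc) ?_ r)
  have : w =ᶠ[𝓝 c] fun _ => 0 := by
    filter_upwards [Ioo_mem_nhds hc.1 hc.2] with x hx using hcon x hx
  exact ((h.hasDerivAt c).congr_of_eventuallyEq this.symm).unique (hasDerivAt_const c 0)

/-- Sturm comparison: between two zeros of a solution there is a zero of every solution of an
equation with a smaller potential. -/
theorem IsSolution.exists_zero_Ioo (hu : IsSolution q₁ u u')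
    (hv : IsSolution q₂ v v') (hq : ∀ r, q₂ r < q₁ r) (hq₁ : Continuous q₁)
    (hne : ∃ r, u r ≠ 0) {a b : ℝ} (hab : a < b) (ha : u a = 0)
    (hb : u b = 0) : ∃ c ∈ Set.Ioo a b, v c = 0 := by
  -- Around a point `c` with `u c ≠ 0`, take the nearest zeros `x < c < y`; this reduces to
  -- consecutive zeros without knowing that zeros are isolated.
  obtain ⟨c, hc, hc0⟩ := hu.exists_ne_zero_Ioo hq₁ hne hab
  have hcl : IsClosed {x | u x = 0} := isClosed_eq hu.continuous continuous_const
  obtain ⟨x, ⟨⟨hax, hxc⟩, hx0⟩, hxmax⟩ := ((isCompact_Icc (a := a) (b := c)).inter_right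
    hcl).exists_isGreatest ⟨a, ⟨le_rfl, hc.1.le⟩, ha⟩
  obtain ⟨y, ⟨⟨hcy, hyb⟩, hy0⟩, hymin⟩ := ((isCompact_Icc (a := c) (b := b)).inter_right
    hcl).exists_isLeast ⟨b, ⟨hc.2.le, le_rfl⟩, hb⟩
  have hxc' : x < c := lt_of_le_of_ne hxc fun h => hc0 (h ▸ hx0)
  have hcy' : c < y := lt_of_le_of_ne hcy fun h => hc0 (h ▸ hy0)
  obtain ⟨z, hz, hz0⟩ := hu.exists_zero_Ioo_of_ne_zero hv hq (hxc'.trans hcy') hx0 hy0 (by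
    intro r hr hr0
    rcases le_total r c with hrc | hrc
    · exact absurd (hxmax ⟨⟨hax.trans hr.1.le, hrc⟩, hr0⟩) (not_le.2 hr.1)
    · exact absurd (hymin ⟨⟨hrc, hr.2.le.trans hyb⟩, hr0⟩) (not_le.2 hr.2))
  exact ⟨z, ⟨hax.trans_lt hz.1, hz.2.trans_le hyb⟩, hz0⟩

/-- Sturm comparison on a half-line, for square integrable solutions. -/
theorem IsSolution.exists_zero_Ioi (hu : IsSolution q₁ u u') (hv : IsSolution q₂ v v')
    (hq : ∀ r, q₂ r < q₁ r) (hq₁ : Continuous q₁) (hq₂ : Continuous q₂)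
    (hne : ∃ r, u r ≠ 0) {a C : ℝ}
    (hC₁ : ∀ r, a ≤ r → |q₁ r| ≤ C) (hC₂ : ∀ r, a ≤ r → |q₂ r| ≤ C)
    (hiu : IntegrableOn (fun r => u r ^ 2) (Set.Ioi a))
    (hiv : IntegrableOn (fun r => v r ^ 2) (Set.Ioi a)) (ha : u a = 0) :
    ∃ c ∈ Set.Ioi a, v c = 0 := by
  by_cases hu0 : ∃ b ∈ Set.Ioi a, u b = 0
  · obtain ⟨b, hab, hb⟩ := hu0
    obtain ⟨c, hc, h⟩ := hu.exists_zero_Ioo hv hq hq₁ hne hab ha hb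
    exact ⟨c, hc.1, h⟩
  by_contra! hcon
  push Not at hu0
  have hiu' : IntegrableOn (fun r => (-u r) ^ 2) (Set.Ioi a) := by simpa using hiu
  have hiv' : IntegrableOn (fun r => (-v r) ^ 2) (Set.Ioi a) := by simpa using hiv
  rcases forall_pos_or_forall_neg_of_isPreconnected isPreconnected_Ioi hu.continuous.continuousOn
    hu0 with h1 | h1 <;>
  rcases forall_pos_or_forall_neg_of_isPreconnected isPreconnected_Ioi hv.continuous.continuousOn
    hcon with h2 | h2
  · exact hu.false_of_pos_Ioi hv hq hq₁ hq₂ hC₁ hC₂ hiu hiv ha h1 h2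
  · exact hu.false_of_pos_Ioi hv.neg hq hq₁ hq₂ hC₁ hC₂ hiu hiv' ha h1
      fun r hr => neg_pos.2 (h2 r hr)
  · exact hu.neg.false_of_pos_Ioi hv hq hq₁ hq₂ hC₁ hC₂ hiu' hiv (by simp [ha])
      (fun r hr => neg_pos.2 (h1 r hr)) h2
  · exact hu.neg.false_of_pos_Ioi hv.neg hq hq₁ hq₂ hC₁ hC₂ hiu' hiv' (by simp [ha])
      (fun r hr => neg_pos.2 (h1 r hr)) fun r hr => neg_pos.2 (h2 r hr)

end Comparison

/-! ### Counting interlacing sets -/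

/-- If `B` meets every interval between two points of `A ∪ {a}` and every half-line that starts at
such a point, where `a` lies to the left of `A`, then `B` has at least one more element. -/
theorem encard_add_one_le_of_interlacing {A B : Set ℝ} {a : ℝ} (hA : ∀ x ∈ A, a < x)
    (hIoo : ∀ x ∈ insert a A, ∀ y ∈ A, x < y → ∃ c ∈ B, x < c ∧ c < y)
    (hIoi : ∀ x ∈ insert a A, ∃ c ∈ B, x < c) : A.encard + 1 ≤ B.encard := by
  -- Here `b` is the largest element of `T`, or `a` when `T` is empty. Counting only the part of `B`
  -- below `b` leaves room for the additional point supplied by `hIoi`.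
  have key : ∀ T : Finset ℝ, (T : Set ℝ) ⊆ A → ∀ b ∈ insert a A, (∀ x ∈ T, x ≤ b) →
      (b = a ∧ T = ∅) ∨ b ∈ T → (T.card : ℕ∞) ≤ (B ∩ Set.Iio b).encard := by
    intro T
    induction T using Finset.induction_on_max with
    | empty => simp
    | insert m T hm ih =>
      intro hT b hb hle hbT
      have hmA : m ∈ A := hT (by simp)
      have hbm : b = m := by
        rcases hbT with ⟨-, h⟩ | h
        · simp at h
        · exact le_antisymm ((Finset.mem_insert.1 h).elim (fun h => h.le) fun h => (hm b h).le)
            (hle m (by simp))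
      subst hbm
      have hTA : (T : Set ℝ) ⊆ A := fun x hx => hT (by simp [Finset.mem_coe.1 hx])
      obtain ⟨b', hb', hb'b, hle', hb'T⟩ : ∃ b' ∈ insert a A, b' < b ∧ (∀ x ∈ T, x ≤ b') ∧
          ((b' = a ∧ T = ∅) ∨ b' ∈ T) := by
        rcases T.eq_empty_or_nonempty with h | h
        · exact ⟨a, by simp, hA b hmA, by simp [h], .inl ⟨rfl, h⟩⟩
        · exact ⟨T.max' h, Set.mem_insert_of_mem _ (hTA (T.max'_mem h)), hm _ (T.max'_mem h),
            fun x hx => T.le_max' x hx, .inr (T.max'_mem h)⟩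
      obtain ⟨c, hcB, hc1, hc2⟩ := hIoo b' hb' b hmA hb'b
      rw [Finset.card_insert_of_notMem fun h => lt_irrefl _ (hm b h)]
      push_cast
      calc (T.card : ℕ∞) + 1 ≤ (B ∩ Set.Iio b').encard + 1 := by
            gcongr; exact ih hTA b' hb' hle' hb'T
        _ = (insert c (B ∩ Set.Iio b')).encard :=
            (Set.encard_insert_of_notMem fun h => lt_asymm hc1 h.2).symm
        _ ≤ _ := by
            refine Set.encard_le_encard (Set.insert_subset ⟨hcB, hc2⟩ ?_)
            exact fun x hx => ⟨hx.1, lt_trans hx.2 hb'b⟩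
  have key' : ∀ T : Finset ℝ, (T : Set ℝ) ⊆ A → (T.card : ℕ∞) + 1 ≤ B.encard := by
    intro T hT
    obtain ⟨b, hb, hle, hbT⟩ : ∃ b ∈ insert a A, (∀ x ∈ T, x ≤ b) ∧
        ((b = a ∧ T = ∅) ∨ b ∈ T) := by
      rcases T.eq_empty_or_nonempty with h | h
      · exact ⟨a, by simp, by simp [h], .inl ⟨rfl, h⟩⟩
      · exact ⟨T.max' h, Set.mem_insert_of_mem _ (hT (T.max'_mem h)),
          fun x hx => T.le_max' x hx, .inr (T.max'_mem h)⟩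
    obtain ⟨c, hcB, hc⟩ := hIoi b hb
    calc (T.card : ℕ∞) + 1 ≤ (B ∩ Set.Iio b).encard + 1 := by
          gcongr; exact key T hT b hb hle hbT
      _ = (insert c (B ∩ Set.Iio b)).encard :=
          (Set.encard_insert_of_notMem fun h => lt_asymm hc h.2).symm
      _ ≤ _ := Set.encard_le_encard (Set.insert_subset hcB Set.inter_subset_left)
  rcases A.finite_or_infinite with hfin | hinf
  · have := key' hfin.toFinset (by simp)
    rwa [← Set.encard_coe_eq_coe_finsetCard, hfin.coe_toFinset] at this
  · suffices B.encard = ⊤ by simp [this]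
    refine ENat.eq_top_iff_forall_ge.2 fun n => ?_
    obtain ⟨T, hT, hcard⟩ := hinf.exists_subset_card_eq n
    exact le_self_add.trans (hcard ▸ key' T hT)

/-! ### Finiteness of the zero set -/

/-- A nontrivial solution has finitely many zeros in `[0, ∞)` if the potential is eventually
positive. -/
theorem IsSolution.finite_zeros {q w w' : ℝ → ℝ} (h : IsSolution q w w') (hq : Continuous q)
    (hne : ∃ r, w r ≠ 0) {R : ℝ} (hR : ∀ r, R ≤ r → 0 < q r) {a : ℝ} :
    {r | a < r ∧ w r = 0}.Finite := by
  -- At an accumulation point of zeros both `w` and `w'` vanish, so `w` is identically zero.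
  have h1 : ({r | w r = 0} ∩ Set.Icc a R).Finite := by
    by_contra hinf
    obtain ⟨p, -, hp⟩ := Set.Infinite.exists_accPt_of_subset_isCompact hinf isCompact_Icc
      Set.inter_subset_right
    have hfr : ∃ᶠ x in 𝓝[≠] p, w x = 0 := by
      rw [accPt_iff_frequently_nhdsNE] at hp
      exact hp.mono fun x hx => hx.1
    have hp0 : w p = 0 := by
      by_contra hp0
      exact hfr ((h.continuous.continuousAt.eventually_ne hp0).filter_mono nhdsWithin_le_nhds)
    have hp1 : w' p = 0 := by
      by_contra hp1
      have := (h.hasDerivAt p).eventually_ne (c := 0) hp1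
      exact hfr (by simpa using this)
    obtain ⟨r, hr⟩ := hne
    exact hr (h.eq_zero hq hp0 hp1 r)
  -- Where `q > 0`, `w w'` is nondecreasing; between two zeros it would vanish identically, and so
  -- would its derivative `w'² + q w²`.
  have h2 : ({r | w r = 0} ∩ Set.Ici R).Subsingleton := by
    have hlt : ∀ x y, w x = 0 → w y = 0 → R ≤ x → ¬ x < y := by
      intro x y hx hy hRx hxy
      have hd : ∀ r, HasDerivAt (fun r => w r * w' r) (w' r ^ 2 + q r * w r ^ 2) r := fun r =>
        ((h.hasDerivAt r).mul (h.hasDerivAt' r)).congr_deriv (by ring)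
      have hmono : MonotoneOn (fun r => w r * w' r) (Set.Icc x y) := by
        refine monotoneOn_of_deriv_nonneg (convex_Icc _ _)
          (fun r _ => (hd r).continuousAt.continuousWithinAt)
          (fun r _ => (hd r).differentiableAt.differentiableWithinAt) fun r hr => ?_
        rw [interior_Icc] at hr
        rw [(hd r).deriv]
        have := hR r (hRx.trans hr.1.le)
        positivity
      obtain ⟨c, hc, hc0⟩ := h.exists_ne_zero_Ioo hq hne hxy
      have hzero : (fun r => w r * w' r) =ᶠ[𝓝 c] fun _ => 0 := by
        filter_upwards [Ioo_mem_nhds hc.1 hc.2] with r hr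
        have e1 := hmono (Set.left_mem_Icc.2 hxy.le) (Set.Ioo_subset_Icc_self hr) hr.1.le
        have e2 := hmono (Set.Ioo_subset_Icc_self hr) (Set.right_mem_Icc.2 hxy.le) hr.2.le
        simp only [hx, hy, zero_mul] at e1 e2
        linarith
      have := ((hd c).congr_of_eventuallyEq hzero.symm).unique (hasDerivAt_const c 0)
      have hqc := hR c (hRx.trans hc.1.le)
      have : 0 < w' c ^ 2 + q c * w c ^ 2 := by positivity
      linarith
    intro x hx y hy
    by_contra hxy
    rcases lt_or_gt_of_ne hxy with hxy | hxy
    · exact hlt x y hx.1 hy.1 hx.2 hxy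
    · exact hlt y x hy.1 hx.1 hy.2 hxy
  refine (h1.union h2.finite).subset fun r hr => ?_
  rcases le_total r R with hrR | hrR
  · exact .inl ⟨hr.2, hr.1.le, hrR⟩
  · exact .inr ⟨hr.2, hrR⟩

/-! ### Distributional derivatives on the half-line -/

/-- Smooth functions with compact support in `(0, ∞)`. -/
structure IsHalfLineTest (k : ℝ → ℝ) : Prop where
  contDiff : ContDiff ℝ ∞ k
  exists_Icc : ∃ a b : ℝ, 0 < a ∧ ∀ x, x ∉ Set.Icc a b → k x = 0

namespace IsHalfLineTest

variable {k φ : ℝ → ℝ}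

theorem of_tsupport_subset (h : ContDiff ℝ ∞ k) (hc : HasCompactSupport k)
    (hs : tsupport k ⊆ Set.Ioi 0) : IsHalfLineTest k := by
  refine ⟨h, ?_⟩
  rcases (tsupport k).eq_empty_or_nonempty with he | hne
  · exact ⟨1, 1, one_pos, fun x _ => image_eq_zero_of_notMem_tsupport (by simp [he])⟩
  · have hc' : IsCompact (tsupport k) := hc
    obtain ⟨a, ha, hal⟩ := hc'.exists_isLeast hne
    obtain ⟨b, hb, hbl⟩ := hc'.exists_isGreatest hne
    exact ⟨a, b, hs ha, fun x hx => image_eq_zero_of_notMem_tsupport fun hxs =>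
      hx ⟨hal hxs, hbl hxs⟩⟩

theorem hasCompactSupport (h : IsHalfLineTest k) : HasCompactSupport k := by
  obtain ⟨a, b, -, hab⟩ := h.exists_Icc
  exact HasCompactSupport.intro isCompact_Icc fun x hx => hab x hx

theorem differentiable (h : IsHalfLineTest k) : Differentiable ℝ k :=
  h.contDiff.differentiable (by simp)

theorem continuous (h : IsHalfLineTest k) : Continuous k := h.contDiff.continuous

theorem deriv (h : IsHalfLineTest k) : IsHalfLineTest (deriv k) := by
  refine ⟨(contDiff_infty_iff_deriv.1 h.contDiff).2, ?_⟩
  obtain ⟨a, b, ha, hab⟩ := h.exists_Icc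
  refine ⟨a, b, ha, fun x hx => ?_⟩
  have : k =ᶠ[𝓝 x] fun _ => 0 := by
    filter_upwards [isClosed_Icc.isOpen_compl.mem_nhds hx] with y hy using hab y hy
  rw [this.deriv_eq, deriv_const]

theorem integrable (h : IsHalfLineTest k) : Integrable k :=
  h.continuous.integrable_of_hasCompactSupport h.hasCompactSupport

theorem integrable_mul (h : IsHalfLineTest k) {v : ℝ → ℝ} (hv : LocallyIntegrable v) :
    Integrable fun x => v x * k x := by
  simpa [mul_comm] using
    hv.integrable_smul_left_of_hasCompactSupport h.continuous h.hasCompactSupport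

theorem sub_const_mul (h : IsHalfLineTest k) (hφ : IsHalfLineTest φ) (c : ℝ) :
    IsHalfLineTest fun x => k x - c * φ x := by
  obtain ⟨a, b, ha, hab⟩ := h.exists_Icc
  obtain ⟨a', b', ha', hab'⟩ := hφ.exists_Icc
  refine ⟨h.contDiff.sub (contDiff_const.mul hφ.contDiff), min a a', max b b', lt_min ha ha',
    fun x hx => ?_⟩
  rw [hab x fun hx' => hx ⟨(min_le_left _ _).trans hx'.1, hx'.2.trans (le_max_left _ _)⟩,
    hab' x fun hx' => hx ⟨(min_le_right _ _).trans hx'.1, hx'.2.trans (le_max_right _ _)⟩]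
  simp

/-- Zero mean is exactly what makes the primitive from `0` vanish again to the right of the support.
-/
theorem exists_primitive (h : IsHalfLineTest φ) (h0 : ∫ x, φ x = 0) :
    ∃ k, IsHalfLineTest k ∧ _root_.deriv k = φ := by
  obtain ⟨a, b, ha, hab⟩ := h.exists_Icc
  have hd : ∀ x, HasDerivAt (fun x => ∫ t in (0 : ℝ)..x, φ t) (φ x) x := fun x =>
    intervalIntegral.integral_hasDerivAt_right (h.continuous.intervalIntegrable _ _)
      h.continuous.aestronglyMeasurable.stronglyMeasurableAtFilter h.continuous.continuousAt
  have hd' : _root_.deriv (fun x => ∫ t in (0 : ℝ)..x, φ t) = φ := funext fun x => (hd x).deriv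
  refine ⟨_, ⟨contDiff_infty_iff_deriv.2 ⟨fun x => (hd x).differentiableAt, ?_⟩, a, b, ha,
    fun x hx => ?_⟩, hd'⟩
  · rw [hd']; exact h.contDiff
  · rw [Set.mem_Icc, not_and_or, not_le, not_le] at hx
    rcases lt_or_ge x a with hxa | hxa
    · refine intervalIntegral.integral_zero_ae (Eventually.of_forall fun t ht => hab t fun ht' => ?_)
      have := ht.2
      exact absurd (ht'.1.trans this) (not_le.2 (max_lt ha hxa))
    · have hxb := hx.resolve_left (not_lt.2 hxa)
      rw [intervalIntegral.integral_eq_integral_of_support_subset, h0]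
      intro t ht
      by_contra hcon
      exact ht (hab t fun ht' => hcon ⟨ha.trans_le ht'.1, ht'.2.trans hxb.le⟩)

theorem exists_integral_eq_one : ∃ k, IsHalfLineTest k ∧ ∫ x, k x = 1 := by
  let f : ContDiffBump (2 : ℝ) := ⟨1 / 2, 1, by norm_num, by norm_num⟩
  refine ⟨f.normed volume, ⟨f.contDiff_normed, 1, 3, one_pos, fun x hx => ?_⟩,
    f.integral_normed⟩
  have : x ∉ Function.support (f.normed volume) := by
    rw [f.support_normed_eq]
    intro hx'
    rw [Real.ball_eq_Ioo] at hx'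
    have h1 : (2 : ℝ) - 1 < x := hx'.1
    have h2 : x < (2 : ℝ) + 1 := hx'.2
    exact hx ⟨by linarith, by linarith⟩
  simpa using this

end IsHalfLineTest

/-- A locally integrable function whose distributional derivative on `(0, ∞)` vanishes is
constant. -/
theorem ae_eq_const_of_integral_mul_deriv_eq_zero {v : ℝ → ℝ} (hv : LocallyIntegrable v)
    (H : ∀ k, IsHalfLineTest k → ∫ x, v x * deriv k x = 0) :
    ∃ c, ∀ᵐ x, x ∈ Set.Ioi (0 : ℝ) → v x = c := by
  obtain ⟨ρ, hρ, hρ1⟩ := IsHalfLineTest.exists_integral_eq_one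
  refine ⟨∫ x, v x * ρ x, ?_⟩
  have := isOpen_Ioi.ae_eq_zero_of_integral_contDiff_smul_eq_zero (U := Set.Ioi (0 : ℝ))
    (f := fun x => v x - ∫ x, v x * ρ x) (μ := volume)
    ((hv.sub (locallyIntegrable_const _)).locallyIntegrableOn _) ?_
  · filter_upwards [this] with x hx hx0 using sub_eq_zero.1 (hx hx0)
  · intro φ hφ hφc hφs
    have hφt := IsHalfLineTest.of_tsupport_subset hφ hφc hφs
    -- Subtracting `(∫ φ) ρ` makes the mean zero, so the difference is an admissible `deriv k`.
    have hψ := hφt.sub_const_mul hρ (∫ x, φ x)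
    obtain ⟨k, hk, hkd⟩ := hψ.exists_primitive (by
      rw [integral_sub hφt.integrable (hρ.integrable.const_mul _), integral_const_mul, hρ1]; simp)
    have h1 := H k hk
    rw [hkd] at h1
    have e1 : (fun x => v x * (φ x - (∫ x, φ x) * ρ x)) =
        fun x => v x * φ x - (∫ x, φ x) * (v x * ρ x) := by ext x; ring
    rw [e1, integral_sub (hφt.integrable_mul hv) ((hρ.integrable_mul hv).const_mul _),
      integral_const_mul] at h1
    have e2 : (fun x => φ x • (v x - ∫ x, v x * ρ x)) =
        fun x => v x * φ x - (∫ x, v x * ρ x) * φ x := by ext x; simp only [smul_eq_mul]; ring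
    rw [e2, integral_sub (hφt.integrable_mul hv) (hφt.integrable.const_mul _),
      integral_const_mul]
    linarith

/-- A locally integrable function whose second distributional derivative on `(0, ∞)` vanishes is
affine. -/
theorem ae_eq_affine_of_integral_mul_deriv_deriv_eq_zero {v : ℝ → ℝ} (hv : LocallyIntegrable v)
    (H : ∀ k, IsHalfLineTest k → ∫ x, v x * deriv (deriv k) x = 0) :
    ∃ a b, ∀ᵐ x, x ∈ Set.Ioi (0 : ℝ) → v x = a + b * x := by
  obtain ⟨ρ, hρ, hρ1⟩ := IsHalfLineTest.exists_integral_eq_one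
  -- The slope: an affine function `a + b x` paired with `deriv ρ` gives `-b`, as `∫ ρ = 1`.
  -- Removing `B x` leaves a function with vanishing first derivative.
  set B := -∫ x, v x * deriv ρ x with hB
  have hid : LocallyIntegrable fun x : ℝ => B * x :=
    (continuous_const.mul continuous_id).locallyIntegrable
  have key : ∀ φ, IsHalfLineTest φ → ∫ x, (v x - B * x) * deriv φ x = 0 := by
    intro φ hφ
    have hψ := hφ.sub_const_mul hρ (∫ x, φ x)
    obtain ⟨k, hk, hkd⟩ := hψ.exists_primitive (by
      rw [integral_sub hφ.integrable (hρ.integrable.const_mul _), integral_const_mul, hρ1]; simp)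
    have h1 := H k hk
    have hkdd : deriv (deriv k) = fun x => deriv φ x - (∫ x, φ x) * deriv ρ x := by
      ext x
      rw [hkd]
      exact (((hφ.differentiable x).hasDerivAt).sub
        ((hρ.differentiable x).hasDerivAt.const_mul _)).deriv
    rw [hkdd] at h1
    have e1 : (fun x => v x * (deriv φ x - (∫ x, φ x) * deriv ρ x)) =
        fun x => v x * deriv φ x - (∫ x, φ x) * (v x * deriv ρ x) := by ext x; ring
    rw [e1, integral_sub (hφ.deriv.integrable_mul hv) ((hρ.deriv.integrable_mul hv).const_mul _),
      integral_const_mul] at h1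
    have h2 : ∫ x, x * deriv φ x = -∫ x, φ x := by
      have := integral_mul_deriv_eq_deriv_mul_of_integrable (u := fun x : ℝ => x)
        (u' := fun _ => 1) (v := φ) (v' := deriv φ) (fun x _ => hasDerivAt_id x)
        (fun x _ => (hφ.differentiable x).hasDerivAt)
        (hφ.deriv.integrable_mul continuous_id.locallyIntegrable)
        (by simpa [Pi.mul_def] using hφ.integrable)
        (hφ.integrable_mul continuous_id.locallyIntegrable)
      simpa using this
    have e2 : (fun x => (v x - B * x) * deriv φ x) =
        fun x => v x * deriv φ x - B * (x * deriv φ x) := by ext x; ring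
    rw [e2, integral_sub (hφ.deriv.integrable_mul hv)
      ((hφ.deriv.integrable_mul (v := fun x => x) continuous_id.locallyIntegrable).const_mul _),
      integral_const_mul, h2]
    linarith
  obtain ⟨c, hc⟩ := ae_eq_const_of_integral_mul_deriv_eq_zero (v := fun x => v x - B * x)
    (hv.sub hid) key
  refine ⟨c, B, ?_⟩
  filter_upwards [hc] with x hx hx0
  linarith [hx hx0]

theorem intervalIntegrable_of_locallyIntegrable {g : ℝ → ℝ} (hg : LocallyIntegrable g)
    (a b : ℝ) :
    IntervalIntegrable g volume a b :=
  intervalIntegrable_iff.2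
    ((hg.integrableOn_isCompact isCompact_uIcc).mono_set Set.uIoc_subset_uIcc)

theorem continuous_primitive_of_locallyIntegrable {g : ℝ → ℝ} (hg : LocallyIntegrable g) :
    Continuous fun x => ∫ t in (0 : ℝ)..x, g t :=
  intervalIntegral.continuous_primitive (fun a b => intervalIntegrable_of_locallyIntegrable hg a b) 0

/-- Integration by parts twice against the second primitive of a locally integrable function. -/
theorem integral_second_primitive_mul_deriv_deriv {g k : ℝ → ℝ} (hg : LocallyIntegrable g)
    (hk : ContDiff ℝ ∞ k) {T : ℝ} (hk0 : k T = 0) (hk1 : deriv k T = 0) :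
    ∫ x in (0 : ℝ)..T, (∫ s in (0 : ℝ)..x, ∫ t in (0 : ℝ)..s, g t) * deriv (deriv k) x =
      ∫ x in (0 : ℝ)..T, g x * k x := by
  have hk' : ContDiff ℝ ∞ (deriv k) := (contDiff_infty_iff_deriv.1 hk).2
  have hk'' : ContDiff ℝ ∞ (deriv (deriv k)) := (contDiff_infty_iff_deriv.1 hk').2
  have hP := continuous_primitive_of_locallyIntegrable hg
  have h1 := intervalIntegral.integral_mul_deriv_eq_deriv_mul (a := 0) (b := T)
    (u := fun x => ∫ s in (0 : ℝ)..x, ∫ t in (0 : ℝ)..s, g t)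
    (u' := fun s => ∫ t in (0 : ℝ)..s, g t) (v := deriv k) (v' := deriv (deriv k))
    (fun x _ => intervalIntegral.integral_hasDerivAt_right (hP.intervalIntegrable _ _)
      hP.aestronglyMeasurable.stronglyMeasurableAtFilter hP.continuousAt)
    (fun x _ => ((hk'.differentiable (by simp)) x).hasDerivAt)
    (hP.intervalIntegrable _ _) (hk''.continuous.intervalIntegrable _ _)
  -- The inner primitive is only absolutely continuous, since `g` is merely locally integrable.
  have h2 := AbsolutelyContinuousOnInterval.integral_mul_deriv_eq_deriv_mul (a := 0) (b := T)
    (f := fun s => ∫ t in (0 : ℝ)..s, g t) (g := k)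
    ((intervalIntegrable_of_locallyIntegrable hg 0 T).absolutelyContinuousOnInterval_intervalIntegral
      (by simp))
    ((hk.of_le (by simp)).contDiffOn.absolutelyContinuousOnInterval)
  have h3 : ∫ x in (0 : ℝ)..T, deriv (fun s => ∫ t in (0 : ℝ)..s, g t) x * k x =
      ∫ x in (0 : ℝ)..T, g x * k x := by
    refine intervalIntegral.integral_congr_ae ?_
    filter_upwards [LocallyIntegrable.ae_hasDerivAt_integral hg] with x hx _
    rw [(hx 0).deriv]
  rw [h1, h2, h3]
  simp [hk0, hk1]

/-! ### Regularity up to the origin -/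

/-- A test function on the half-line is of the form `r p(r²)`. -/
theorem IsHalfLineTest.exists_eq_mul_comp_sq {k : ℝ → ℝ} (hk : IsHalfLineTest k) :
    ∃ p : ℝ → ℝ, ContDiff ℝ ∞ p ∧ HasCompactSupport p ∧ ∀ r, 0 < r → k r = r * p (r ^ 2) := by
  obtain ⟨a, b, ha, hab⟩ := hk.exists_Icc
  have hz : ∀ t, t < a ^ 2 → k (√t) / √t = 0 := by
    intro t ht
    rw [hab, zero_div]
    intro h
    exact absurd ((Real.le_sqrt' ha).1 h.1) (not_le.2 ht)
  -- The quotient vanishes for `t < a²`, so the singularity of the square root at `0` does no harm.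
  refine ⟨fun t => k (√t) / √t, contDiff_iff_contDiffAt.2 fun t => ?_, ?_, fun r hr => ?_⟩
  · rcases lt_or_ge t (a ^ 2) with ht | ht
    · refine (contDiffAt_const (c := (0 : ℝ))).congr_of_eventuallyEq ?_
      filter_upwards [Iio_mem_nhds ht] with s hs using hz s hs
    · have ht0 : 0 < t := lt_of_lt_of_le (by positivity) ht
      have hs : ContDiffAt ℝ ∞ Real.sqrt t := Real.contDiffAt_sqrt ht0.ne'
      exact (hk.contDiff.contDiffAt.comp t hs).div hs (Real.sqrt_pos.2 ht0).ne'
  · refine HasCompactSupport.intro (isCompact_Icc (a := a ^ 2) (b := b ^ 2)) fun t ht => ?_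
    rcases lt_or_ge t (a ^ 2) with h | h
    · exact hz t h
    · rw [hab, zero_div]
      intro hs
      refine ht ⟨h, ?_⟩
      exact (Real.sqrt_le_left (ha.le.trans (hs.1.trans hs.2))).1 hs.2
  · simp only [Real.sqrt_sq hr.le]
    field_simp

theorem ae_eq_of_odd {f g : ℝ → ℝ} (hf : ∀ r, f (-r) = -f r) (hg : ∀ r, g (-r) = -g r)
    (h : ∀ᵐ r, r ∈ Set.Ioi (0 : ℝ) → f r = g r) : f =ᵐ[volume] g := by
  have hneg := (Measure.measurePreserving_neg (volume : Measure ℝ)).quasiMeasurePreserving.ae h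
  have h0 : ∀ᵐ r : ℝ, r ≠ 0 := by simp [ae_iff]
  filter_upwards [h, hneg, h0] with r h1 h2 h3
  rcases lt_or_gt_of_ne h3 with hr | hr
  · have := h2 (by simpa using hr)
    rw [hf, hg] at this
    linarith
  · exact h1 hr

/-- Regularity: a distributional solution of `w'' = q w` on `(0, ∞)` which is tested also by
functions `r p(r²)` agrees with a classical solution that vanishes at the origin. -/
theorem exists_isSolution_of_weak {q w : ℝ → ℝ} (hq : Continuous q) (hqe : ∀ r, q (-r) = q r)
    (hw : LocallyIntegrable w) (hwo : ∀ r, w (-r) = -w r)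
    (H : ∀ p : ℝ → ℝ, ContDiff ℝ ∞ p → HasCompactSupport p →
      ∫ r in Set.Ioi 0, w r * deriv (deriv fun r => r * p (r ^ 2)) r =
        ∫ r in Set.Ioi 0, q r * w r * (r * p (r ^ 2))) :
    ∃ W W', IsSolution q W W' ∧ W 0 = 0 ∧ ∀ᵐ r, r ∈ Set.Ioi (0 : ℝ) → w r = W r := by
  set g : ℝ → ℝ := fun r => q r * w r with hgdef
  have hg : LocallyIntegrable g := by
    rw [← locallyIntegrableOn_univ] at hw ⊢
    exact hw.continuousOn_mul hq.continuousOn isOpen_univ.isLocallyClosed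
  set P : ℝ → ℝ := fun s => ∫ t in (0 : ℝ)..s, g t with hPdef
  set U : ℝ → ℝ := fun x => ∫ s in (0 : ℝ)..x, P s with hUdef
  have hP : Continuous P := continuous_primitive_of_locallyIntegrable hg
  have hU' : ∀ r, HasDerivAt U (P r) r := fun r =>
    intervalIntegral.integral_hasDerivAt_right (hP.intervalIntegrable _ _)
      hP.aestronglyMeasurable.stronglyMeasurableAtFilter hP.continuousAt
  have hU : Continuous U := continuous_iff_continuousAt.2 fun r => (hU' r).continuousAt
  have hgo : ∀ r, g (-r) = -g r := fun r => by simp [hgdef, hqe, hwo]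
  have hPe : ∀ r, P (-r) = P r := by
    intro r
    have := intervalIntegral.integral_comp_neg (a := 0) (b := r) g
    simp only [hgo, neg_zero, intervalIntegral.integral_neg] at this
    rw [hPdef]
    simp only
    rw [intervalIntegral.integral_symm, ← this, neg_neg]
  have hUo : ∀ r, U (-r) = -U r := by
    intro r
    have := intervalIntegral.integral_comp_neg (a := 0) (b := r) P
    simp only [hPe, neg_zero] at this
    rw [hUdef]
    simp only
    rw [intervalIntegral.integral_symm, ← this]
  -- `U` is a second primitive of `q w`, so `w - U` has zero second derivative as a distribution on
  -- the open half-line.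
  obtain ⟨a, B, haB⟩ := ae_eq_affine_of_integral_mul_deriv_deriv_eq_zero
    (v := fun x => w x - U x) (hw.sub hU.locallyIntegrable) (by
      intro k hk
      obtain ⟨p, hp, hpc, hkp⟩ := hk.exists_eq_mul_comp_sq
      obtain ⟨α, β, hα, hαβ⟩ := hk.exists_Icc
      obtain ⟨α', β', hα', hαβ'⟩ := hk.deriv.deriv.exists_Icc
      set T := max (max β β') 0 + 1
      have hTβ : β < T := ((le_max_left _ _).trans (le_max_left _ _)).trans_lt (lt_add_one _)
      have hTβ' : β' < T := ((le_max_right _ _).trans (le_max_left _ _)).trans_lt (lt_add_one _)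
      have hT0 : 0 < T := (le_max_right _ _).trans_lt (lt_add_one _)
      have hkT : k =ᶠ[𝓝 T] fun _ => 0 := by
        filter_upwards [Ioi_mem_nhds hTβ] with x hx using hαβ x fun h => absurd h.2 (not_le.2 hx)
      have hUk := integral_second_primitive_mul_deriv_deriv hg hk.contDiff (T := T)
        hkT.eq_of_nhds (by rw [hkT.deriv_eq, deriv_const])
      have hH := H p hp hpc
      have e1 : ∫ r in Set.Ioi 0, w r * deriv (deriv fun r => r * p (r ^ 2)) r =
          ∫ r in Set.Ioi 0, w r * deriv (deriv k) r := by
        refine setIntegral_congr_fun measurableSet_Ioi fun r hr => ?_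
        have : k =ᶠ[𝓝 r] fun r => r * p (r ^ 2) := by
          filter_upwards [Ioi_mem_nhds hr] with x hx using hkp x hx
        simp only [this.deriv.deriv_eq]
      have e2 : ∫ r in Set.Ioi 0, q r * w r * (r * p (r ^ 2)) =
          ∫ r in Set.Ioi 0, q r * w r * k r := by
        refine setIntegral_congr_fun measurableSet_Ioi fun r hr => ?_
        simp only [hkp r hr]
      have toR : ∀ (f h : ℝ → ℝ) (c d : ℝ), 0 < c → (∀ x, x ∉ Set.Icc c d → h x = 0) →
          ∫ r in Set.Ioi 0, f r * h r = ∫ r, f r * h r := by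
        intro f h c d hc hh
        refine setIntegral_eq_integral_of_forall_compl_eq_zero fun x hx => ?_
        rw [hh x fun h => hx (hc.trans_le h.1), mul_zero]
      have toI : ∀ (f h : ℝ → ℝ) (c d : ℝ), 0 < c → d < T → (∀ x, x ∉ Set.Icc c d → h x = 0) →
          ∫ r in (0 : ℝ)..T, f r * h r = ∫ r, f r * h r := by
        intro f h c d hc hd hh
        refine intervalIntegral.integral_eq_integral_of_support_subset fun x hx => ?_
        by_contra hcon
        refine hx ?_
        simp only
        rw [hh x fun h => hcon ⟨hc.trans_le h.1, h.2.trans hd.le⟩, mul_zero]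
      rw [e1, e2, toR _ _ _ _ hα' hαβ', toR _ _ _ _ hα hαβ] at hH
      rw [toI U _ _ _ hα' hTβ' hαβ', toI g _ _ _ hα hTβ hαβ] at hUk
      have e3 : (fun x => (w x - U x) * deriv (deriv k) x) =
        fun x => w x * deriv (deriv k) x - U x * deriv (deriv k) x := by ext x; ring
      rw [e3, integral_sub (hk.deriv.deriv.integrable_mul hw)
        (hk.deriv.deriv.integrable_mul hU.locallyIntegrable), hH, hUk, sub_self])
  -- A constant `a ≠ 0` would be a singularity `a/r` of `ψ`, whose Laplacian has a point mass at the
  -- origin. Only a test function not vanishing near `0` detects it: with `k = r p(r²)` and `p 0 =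
  -- 1`, integration by parts gives `∫ (a + B r) k'' = -a k'(0) = -a`, and the weak equation says
  -- this is `0`.
  have ha : a = 0 := by
    obtain ⟨p, hp, hpc, hpz, hp0⟩ : ∃ p : ℝ → ℝ, ContDiff ℝ ∞ p ∧ HasCompactSupport p ∧
        (∀ t, 2 ≤ t → p t = 0) ∧ p 0 = 1 := by
      let p : ContDiffBump (0 : ℝ) := ⟨1, 2, by norm_num, by norm_num⟩
      refine ⟨p, p.contDiff, p.hasCompactSupport, fun t ht => p.zero_of_le_dist ?_,
        p.one_of_mem_closedBall (by simp [p])⟩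
      rw [Real.dist_eq, sub_zero]
      exact ht.trans (le_abs_self t)
    set k : ℝ → ℝ := fun r => r * p (r ^ 2) with hkdef
    have hk : ContDiff ℝ ∞ k := contDiff_id.mul (hp.comp (contDiff_id.pow 2))
    have hk' : ContDiff ℝ ∞ (deriv k) := (contDiff_infty_iff_deriv.1 hk).2
    have hk'' : ContDiff ℝ ∞ (deriv (deriv k)) := (contDiff_infty_iff_deriv.1 hk').2
    have hkz : ∀ x, 3 / 2 < x → k =ᶠ[𝓝 x] fun _ => 0 := by
      intro x hx
      filter_upwards [Ioi_mem_nhds hx] with y hy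
      have hy' : 3 / 2 < y := hy
      rw [hkdef]
      simp only
      rw [hpz _ (by nlinarith), mul_zero]
    have hkd : ∀ x, 3 / 2 < x → deriv k =ᶠ[𝓝 x] fun _ => 0 := by
      intro x hx
      have := (hkz x hx).deriv
      simpa using this
    have hkdd : ∀ x, 3 / 2 < x → deriv (deriv k) x = 0 := fun x hx => by
      rw [(hkd x hx).deriv_eq, deriv_const]
    have h2 : (3 / 2 : ℝ) < 2 := by norm_num
    have hk2 := (hkz 2 h2).eq_of_nhds
    have hkd2 := (hkd 2 h2).eq_of_nhds
    have hk0 : k 0 = 0 := by simp [hkdef]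
    have hk'0 : deriv k 0 = 1 := by
      have hd : HasDerivAt (fun r : ℝ => p (r ^ 2)) (deriv p (0 ^ 2) * (2 * 0 ^ 1 * 1)) 0 := by
        have h1 : HasDerivAt p (deriv p (0 ^ 2)) ((0 : ℝ) ^ 2) :=
          ((hp.differentiable (by simp)) _).hasDerivAt
        have h2 : HasDerivAt (fun r : ℝ => r ^ 2) (2 * 0 ^ 1 * 1) 0 := by
          simpa using hasDerivAt_pow 2 (0 : ℝ)
        exact HasDerivAt.comp (0 : ℝ) h1 h2
      have := ((hasDerivAt_id (0 : ℝ)).mul hd).deriv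
      simp only [id] at this
      rw [hkdef]
      refine Eq.trans this ?_
      simp [hp0]
    have hUk := integral_second_primitive_mul_deriv_deriv hg hk (T := 2) hk2 hkd2
    have hH := H p hp hpc
    have toI : ∀ f h : ℝ → ℝ, (∀ x, 3 / 2 < x → h x = 0) →
        ∫ r in Set.Ioi 0, f r * h r = ∫ r in (0 : ℝ)..2, f r * h r := by
      intro f h hh
      rw [intervalIntegral.integral_of_le (by norm_num)]
      refine setIntegral_eq_of_subset_of_forall_sdiff_eq_zero measurableSet_Ioi
        Set.Ioc_subset_Ioi_self fun x hx => ?_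
      have : 2 < x := by
        by_contra hcon
        exact hx.2 ⟨hx.1, not_lt.1 hcon⟩
      rw [hh x (h2.trans this), mul_zero]
    rw [toI w (deriv (deriv k)) hkdd,
      toI (fun r => q r * w r) k fun x hx => (hkz x hx).eq_of_nhds, ← hUk] at hH
    have e1 : ∫ r in (0 : ℝ)..2, w r * deriv (deriv k) r =
        ∫ r in (0 : ℝ)..2, (U r * deriv (deriv k) r + (a + B * r) * deriv (deriv k) r) := by
      refine intervalIntegral.integral_congr_ae ?_
      filter_upwards [haB] with r hr hr'
      rw [Set.uIoc_of_le (by norm_num)] at hr'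
      rw [← hr hr'.1]
      ring
    have hlin : Continuous fun r : ℝ => a + B * r := by fun_prop
    have e2 := intervalIntegral.integral_add (μ := volume) (a := 0) (b := 2)
      (f := fun r => U r * deriv (deriv k) r) (g := fun r => (a + B * r) * deriv (deriv k) r) ((hU.mul hk''.continuous).intervalIntegrable _ _)
      ((hlin.mul hk''.continuous).intervalIntegrable _ _)
    rw [e1, e2, add_eq_left] at hH
    have i1 := intervalIntegral.integral_mul_deriv_eq_deriv_mul (a := 0) (b := 2)
      (u := fun r => a + B * r) (u' := fun _ => B) (v := deriv k) (v' := deriv (deriv k))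
      (fun x _ => by simpa using ((hasDerivAt_id x).const_mul B).const_add a)
      (fun x _ => ((hk'.differentiable (by simp)) x).hasDerivAt)
      (continuous_const.intervalIntegrable _ _) (hk''.continuous.intervalIntegrable _ _)
    rw [hH, intervalIntegral.integral_const_mul, intervalIntegral.integral_deriv_eq_sub
      (fun x _ => (hk.differentiable (by simp)) x) (hk'.continuous.intervalIntegrable _ _),
      hk2, hkd2, hk0, hk'0] at i1
    linarith
  have hWo : ∀ r, B * -r + U (-r) = -(B * r + U r) := fun r => by rw [hUo]; ring
  have hae : ∀ᵐ r, r ∈ Set.Ioi (0 : ℝ) → w r = B * r + U r := by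
    filter_upwards [haB] with r hr hr0
    have := hr hr0
    rw [ha] at this
    linarith
  have haeR := ae_eq_of_odd hwo hWo hae
  have hWd : ∀ r, HasDerivAt (fun r => B * r + U r) (B + P r) r := fun r => by
    simpa using ((hasDerivAt_id r).const_mul B).fun_add (hU' r)
  have hWc : Continuous fun r => B * r + U r :=
    continuous_iff_continuousAt.2 fun r => (hWd r).continuousAt
  refine ⟨fun r => B * r + U r, fun r => B + P r, ⟨hWd, fun r => ?_⟩, by simp [hUdef], hae⟩
  -- Replacing `w` by its continuous version inside the integral makes `P` continuously
  -- differentiable; oddness lets the a.e. equality hold on both sides of `0`.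
  have hPW : P = fun s => ∫ t in (0 : ℝ)..s, q t * (B * t + U t) := by
    ext s
    refine intervalIntegral.integral_congr_ae ?_
    filter_upwards [haeR] with t ht _
    simp only [hgdef, ht]
  have hqW : Continuous fun t => q t * (B * t + U t) := hq.mul hWc
  have : HasDerivAt P (q r * (B * r + U r)) r := by
    rw [hPW]
    exact intervalIntegral.integral_hasDerivAt_right (hqW.intervalIntegrable _ _)
      hqW.aestronglyMeasurable.stronglyMeasurableAtFilter hqW.continuousAt
  exact this.const_add B

/-! ### Radial test functions and weak gradients in three dimensions -/

theorem inner_gradient_eq_fderiv (φ : E3 → ℝ) (v x : E3) :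
    inner ℝ v (gradient φ x) = fderiv ℝ φ x v := by
  rw [inner_gradient_right]; simp

theorem ContDiff.gradient_of_top {η : E3 → ℝ} (h : ContDiff ℝ ∞ η) :
    ContDiff ℝ ∞ (gradient η) :=
  (InnerProductSpace.toDual ℝ E3).symm.contDiff.comp (h.fderiv_right (m := ∞) (by simp))

theorem HasCompactSupport.gradient' {η : E3 → ℝ} (h : HasCompactSupport η) :
    HasCompactSupport (gradient η) :=
  (h.fderiv ℝ).comp_left (g := (InnerProductSpace.toDual ℝ E3).symm) (map_zero _)

theorem isWeakGradient_gradient {η : E3 → ℝ} (h : ContDiff ℝ ∞ η) (hc : HasCompactSupport η) :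
    IsWeakGradient η (gradient η) := by
  refine ⟨h.continuous.locallyIntegrable, h.gradient_of_top.continuous.locallyIntegrable,
    fun φ hφ hφc => ?_⟩
  have hint1 : Integrable fun x => η x • gradient φ x :=
    (h.continuous.smul hφ.gradient_of_top.continuous).integrable_of_hasCompactSupport hc.smul_right
  have hint2 : Integrable fun x => φ x • gradient η x :=
    (hφ.continuous.smul h.gradient_of_top.continuous).integrable_of_hasCompactSupport
      hφc.smul_right
  refine ext_inner_left ℝ fun v => ?_
  rw [inner_neg_right, ← integral_inner hint1, ← integral_inner hint2]
  simp only [inner_smul_right, inner_gradient_eq_fderiv]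
  have hη' : Continuous fun x => fderiv ℝ η x v :=
    (h.continuous_fderiv (by simp)).clm_apply continuous_const
  have hφ' : Continuous fun x => fderiv ℝ φ x v :=
    (hφ.continuous_fderiv (by simp)).clm_apply continuous_const
  rw [integral_mul_fderiv_eq_neg_fderiv_mul_of_integrable
    ((hη'.mul hφ.continuous).integrable_of_hasCompactSupport hφc.mul_left)
    ((h.continuous.mul hφ').integrable_of_hasCompactSupport hc.mul_right)
    ((h.continuous.mul hφ.continuous).integrable_of_hasCompactSupport hc.mul_right)
    (fun x _ => h.differentiable (by simp) x) (fun x _ => hφ.differentiable (by simp) x)]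
  simp only [mul_comm]

/-- Smooth compactly supported radial functions belong to `H¹_rad`. -/
theorem memH1Rad_of_contDiff {η : E3 → ℝ} (h : ContDiff ℝ ∞ η) (hc : HasCompactSupport η)
    (hr : IsRadialAE η) : MemH1Rad η (gradient η) where
  radial := hr
  memLp := h.continuous.memLp_of_hasCompactSupport hc
  memLp_grad := h.gradient_of_top.continuous.memLp_of_hasCompactSupport hc.gradient'
  weakGrad := isWeakGradient_gradient h hc

section SquaredNorm

variable {p : ℝ → ℝ}

theorem contDiff_comp_norm_sq (hp : ContDiff ℝ ∞ p) : ContDiff ℝ ∞ fun x : E3 => p (‖x‖ ^ 2) :=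
  hp.comp (contDiff_norm_sq ℝ)

theorem hasCompactSupport_comp_norm_sq (hc : HasCompactSupport p) :
    HasCompactSupport fun x : E3 => p (‖x‖ ^ 2) := by
  obtain ⟨R, hR⟩ := hc.isCompact.isBounded.subset_closedBall 0
  refine HasCompactSupport.intro (isCompact_closedBall (0 : E3) (|R| + 1)) fun x hx => ?_
  refine image_eq_zero_of_notMem_tsupport fun h => hx ?_
  have h1 := hR h
  rw [mem_closedBall_zero_iff, Real.norm_of_nonneg (by positivity)] at h1
  rw [mem_closedBall_zero_iff]
  nlinarith [norm_nonneg x, le_abs_self R, abs_nonneg R]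

theorem hasFDerivAt_comp_norm_sq {d : ℝ} {x : E3} (hp : HasDerivAt p d (‖x‖ ^ 2)) :
    HasFDerivAt (fun x : E3 => p (‖x‖ ^ 2)) ((2 * d) • innerSL ℝ x) x := by
  have h1 : HasFDerivAt (fun x : E3 => ‖x‖ ^ 2) (2 • innerSL ℝ x) x :=
    (hasStrictFDerivAt_norm_sq x).hasFDerivAt
  refine (hp.comp_hasFDerivAt x h1).congr_fderiv ?_
  ext y
  simp
  ring

theorem gradient_comp_norm_sq (hp : ContDiff ℝ ∞ p) (x : E3) :
    gradient (fun x : E3 => p (‖x‖ ^ 2)) x = (2 * deriv p (‖x‖ ^ 2)) • x := by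
  refine ext_inner_left ℝ fun v => ?_
  rw [inner_gradient_eq_fderiv, (hasFDerivAt_comp_norm_sq
    (hp.differentiable (by simp) _).hasDerivAt).fderiv, inner_smul_right, real_inner_comm]
  simp

/-- The Laplacian of `p(|x|²)`, as a sum of derivatives of its partial derivatives. -/
theorem sum_fderiv_partial_comp_norm_sq (hp : ContDiff ℝ ∞ p) (x : E3) :
    ∑ i : Fin 3, fderiv ℝ (fun x : E3 => 2 * deriv p (‖x‖ ^ 2) * x i) x
      (EuclideanSpace.single i 1) =
    6 * deriv p (‖x‖ ^ 2) + 4 * ‖x‖ ^ 2 * deriv (deriv p) (‖x‖ ^ 2) := by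
  have hp' : ContDiff ℝ ∞ (deriv p) := (contDiff_infty_iff_deriv.1 hp).2
  have key : ∀ i : Fin 3, fderiv ℝ (fun x : E3 => 2 * deriv p (‖x‖ ^ 2) * x i) x
      (EuclideanSpace.single i 1) =
      2 * deriv p (‖x‖ ^ 2) + 4 * deriv (deriv p) (‖x‖ ^ 2) * x i ^ 2 := by
    intro i
    have h1 := (hasFDerivAt_comp_norm_sq (x := x)
      (hp'.differentiable (by simp) _).hasDerivAt).const_mul 2
    have h2 : HasFDerivAt (fun x : E3 => x i) (EuclideanSpace.proj i : E3 →L[ℝ] ℝ) x :=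
      (EuclideanSpace.proj i : E3 →L[ℝ] ℝ).hasFDerivAt
    rw [(h1.fun_mul h2).fderiv]
    simp [EuclideanSpace.inner_single_right]
    ring
  rw [Finset.sum_congr rfl fun i _ => key i]
  simp only [Fin.sum_univ_three, EuclideanSpace.real_norm_sq_eq]
  ring

/-- The right side is `r` times the Laplacian of `p(|x|²)` at `|x| = r`: the three-dimensional
identity that removes the first-order term from the radial equation. -/
theorem deriv_deriv_mul_comp_sq (hp : ContDiff ℝ ∞ p) (r : ℝ) :
    deriv (deriv fun r => r * p (r ^ 2)) r =
      r * (6 * deriv p (r ^ 2) + 4 * r ^ 2 * deriv (deriv p) (r ^ 2)) := by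
  have hp' : ContDiff ℝ ∞ (deriv p) := (contDiff_infty_iff_deriv.1 hp).2
  have hsq : ∀ r : ℝ, HasDerivAt (fun r : ℝ => r ^ 2) (2 * r) r := fun r => by
    simpa using hasDerivAt_pow 2 r
  have hc : ∀ {g : ℝ → ℝ}, ContDiff ℝ ∞ g → ∀ r,
      HasDerivAt (fun r => g (r ^ 2)) (deriv g (r ^ 2) * (2 * r)) r := fun hg r =>
    HasDerivAt.comp r (hg.differentiable (by simp) _).hasDerivAt (hsq r)
  have h1 : deriv (fun r => r * p (r ^ 2)) =
      fun r => p (r ^ 2) + 2 * r ^ 2 * deriv p (r ^ 2) := by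
    ext r
    rw [((hasDerivAt_id' r).fun_mul (hc hp r)).deriv]
    ring
  rw [h1, ((hc hp r).fun_add (((hsq r).const_mul 2).fun_mul (hc hp' r))).deriv]
  ring

end SquaredNorm

/-- Testing a weak gradient against the gradient of `p(|x|²)`. -/
theorem IsWeakGradient.integral_inner_gradient_comp_norm_sq {u : E3 → ℝ} {G : E3 → E3}
    (h : IsWeakGradient u G) {p : ℝ → ℝ} (hp : ContDiff ℝ ∞ p) (hc : HasCompactSupport p) :
    ∫ x, inner ℝ (G x) (gradient (fun x : E3 => p (‖x‖ ^ 2)) x) =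
      -∫ x, u x * (6 * deriv p (‖x‖ ^ 2) + 4 * ‖x‖ ^ 2 * deriv (deriv p) (‖x‖ ^ 2)) := by
  have hp' : ContDiff ℝ ∞ (deriv p) := (contDiff_infty_iff_deriv.1 hp).2
  let e : Fin 3 → E3 := fun i => EuclideanSpace.single i 1
  -- These are the components of the gradient of `p(|x|²)`; each serves as a scalar test function,
  -- of which the `i`-th coordinate is kept.
  let φ : Fin 3 → E3 → ℝ := fun i x => 2 * deriv p (‖x‖ ^ 2) * x i
  have hφ : ∀ i, ContDiff ℝ ∞ (φ i) := fun i =>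
    (contDiff_const.mul (contDiff_comp_norm_sq hp')).mul
      (EuclideanSpace.proj i : E3 →L[ℝ] ℝ).contDiff
  have hφc : ∀ i, HasCompactSupport (φ i) := fun i =>
    ((hasCompactSupport_comp_norm_sq hc.deriv).mul_left (f := fun _ => (2 : ℝ))).mul_right
  have hφd : ∀ i, Continuous fun x => fderiv ℝ (φ i) x (e i) := fun i =>
    ((hφ i).continuous_fderiv (by simp)).clm_apply continuous_const
  have hφdc : ∀ i, HasCompactSupport fun x => fderiv ℝ (φ i) x (e i) := fun i =>
    ((hφc i).fderiv ℝ).comp_left (g := fun L : E3 →L[ℝ] ℝ => L (e i)) (by simp)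
  have hi1 : ∀ i, Integrable fun x => u x * fderiv ℝ (φ i) x (e i) := fun i => by
    simpa [mul_comm] using h.1.integrable_smul_left_of_hasCompactSupport (hφd i) (hφdc i)
  have hiG : ∀ i, Integrable fun x => φ i x • G x := fun i =>
    h.2.1.integrable_smul_left_of_hasCompactSupport (hφ i).continuous (hφc i)
  have hi2 : ∀ i, Integrable fun x => φ i x * inner ℝ (e i) (G x) := fun i => by
    simpa [inner_smul_right] using (hiG i).const_inner (𝕜 := ℝ) (e i)
  have hcomp : ∀ i, ∫ x, u x * fderiv ℝ (φ i) x (e i) = -∫ x, φ i x * inner ℝ (e i) (G x) := by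
    intro i
    have hiu : Integrable fun x => u x • gradient (φ i) x :=
      h.1.integrable_smul_right_of_hasCompactSupport (hφ i).gradient_of_top.continuous
        (hφc i).gradient'
    have := congrArg (fun y => inner ℝ (e i) y) (h.2.2 (φ i) (hφ i) (hφc i))
    simp only [inner_neg_right] at this
    rw [← integral_inner hiu, ← integral_inner (hiG i)] at this
    simpa only [inner_smul_right, inner_gradient_eq_fderiv] using this
  have e1 : ∀ x, inner ℝ (G x) (gradient (fun x : E3 => p (‖x‖ ^ 2)) x) =
      ∑ i, φ i x * inner ℝ (e i) (G x) := by
    intro x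
    rw [gradient_comp_norm_sq hp, inner_smul_right, PiLp.inner_apply, Finset.mul_sum]
    refine Finset.sum_congr rfl fun i _ => ?_
    simp [φ, e, EuclideanSpace.inner_single_left]
    ring
  have e2 : ∀ x, u x * (6 * deriv p (‖x‖ ^ 2) + 4 * ‖x‖ ^ 2 * deriv (deriv p) (‖x‖ ^ 2)) =
      ∑ i, u x * fderiv ℝ (φ i) x (e i) := by
    intro x
    rw [← Finset.mul_sum, sum_fderiv_partial_comp_norm_sq hp]
  simp only [e1, e2]
  rw [integral_finsetSum _ fun i _ => hi2 i, integral_finsetSum _ fun i _ => hi1 i,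
    ← Finset.sum_neg_distrib]
  refine Finset.sum_congr rfl fun i _ => ?_
  rw [hcomp i, neg_neg]

/-! ### Polar coordinates and reduction to the half-line -/

/-- In polar coordinates the indicator of a null set of radii has integral zero over the whole
space. -/
theorem ae_norm_of_ae_Ioi {P : ℝ → Prop} (h : ∀ᵐ r, r ∈ Set.Ioi (0 : ℝ) → P r) :
    ∀ᵐ x : E3, P ‖x‖ := by
  let N := toMeasurable volume {r | ¬ (r ∈ Set.Ioi (0 : ℝ) → P r)}
  have hN : volume N = 0 := by rw [measure_toMeasurable]; exact h
  have hNm : MeasurableSet N := measurableSet_toMeasurable _ _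
  have hae : (N.indicator fun _ => (1 : ℝ)) =ᵐ[volume] 0 := by
    filter_upwards [compl_mem_ae_iff.2 hN] with r hr using Set.indicator_of_notMem hr _
  have hint : Integrable (fun x : E3 => N.indicator (fun _ => (1 : ℝ)) ‖x‖) := by
    rw [integrable_fun_norm_addHaar (volume : Measure E3) (f := N.indicator fun _ => (1 : ℝ))]
    refine (integrable_zero ℝ ℝ _).congr (ae_restrict_of_ae ?_)
    filter_upwards [hae] with r hr
    simp [hr]
  have h0 : ∫ x : E3, N.indicator (fun _ => (1 : ℝ)) ‖x‖ = 0 := by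
    rw [integral_fun_norm_addHaar (volume : Measure E3) (N.indicator fun _ => (1 : ℝ))]
    rw [integral_eq_zero_of_ae, smul_zero, smul_zero]
    refine ae_restrict_of_ae ?_
    filter_upwards [hae] with r hr
    simp [hr]
  rw [integral_eq_zero_iff_of_nonneg (fun x => Set.indicator_nonneg (by simp) _) hint] at h0
  have hne : ∀ᵐ x : E3, x ≠ 0 := by simp [ae_iff]
  filter_upwards [h0, hne] with x hx hx0
  by_contra hcon
  have : ‖x‖ ∈ N := subset_toMeasurable _ _ fun hP => hcon (hP (norm_pos_iff.2 hx0))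
  simp [Set.indicator_of_mem this] at hx

/-- The profile of a radial `L²` function, multiplied by `r` and extended as an odd function. -/
theorem exists_odd_profile {ψ : E3 → ℝ} (hr : IsRadialAE ψ) (hψ : MemLp ψ 2 volume) :
    ∃ f : ℝ → ℝ, ψ =ᵐ[volume] (fun x => f ‖x‖) ∧
      LocallyIntegrable (fun r => r * f |r|) ∧
      IntegrableOn (fun r => (r * f |r|) ^ 2) (Set.Ioi 0) := by
  obtain ⟨f, hf, hψf⟩ := hr
  have h2 : MemLp (fun x : E3 => f ‖x‖) 2 volume := hψ.ae_eq hψf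
  have h3 : Integrable fun x : E3 => f ‖x‖ ^ 2 :=
    (memLp_two_iff_integrable_sq h2.aestronglyMeasurable).1 h2
  have h4 : IntegrableOn (fun r => (r * f |r|) ^ 2) (Set.Ioi 0) := by
    have := (integrable_fun_norm_addHaar (volume : Measure E3) (f := fun r => f r ^ 2)).1 h3
    refine this.congr_fun (fun r hr => ?_) measurableSet_Ioi
    simp [abs_of_pos (Set.mem_Ioi.1 hr), mul_pow]
  refine ⟨f, hψf, ?_, h4⟩
  have hm : Measurable fun r : ℝ => r * f |r| := measurable_id.mul (hf.comp measurable_id.abs)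
  -- The square is even, so reflection carries integrability to the negative half-line.
  have h5 : Integrable fun r => (r * f |r|) ^ 2 := by
    rw [← integrableOn_univ, ← Set.Iic_union_Ioi (a := (0 : ℝ)), integrableOn_union]
    refine ⟨?_, h4⟩
    have hemb : MeasurableEmbedding fun x : ℝ => -x := (Homeomorph.neg ℝ).measurableEmbedding
    rw [← Measure.map_neg_eq_self (volume : Measure ℝ), hemb.integrableOn_map_iff]
    simpa [Function.comp_def, integrableOn_Ici_iff_integrableOn_Ioi] using h4
  exact ((memLp_two_iff_integrable_sq hm.aestronglyMeasurable).2 h5).locallyIntegrable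
    (by norm_num)

/-- Testing with `p(|x|²)` and passing to polar coordinates turns the form identity into the weak
equation for `r f(r)`. Since `W 0 = 0`, `dslope W 0` is `W(r)/r` continued by `W'(0)`. -/
theorem IsRadialEigenpair.exists_isSolution {V : E3 → ℝ} (hV : Continuous V)
    (hVr : ∀ x y : E3, ‖x‖ = ‖y‖ → V x = V y) {lam : ℝ} {ψ : E3 → ℝ}
    (h : IsRadialEigenpair V lam ψ) :
    ∃ W W' : ℝ → ℝ,
      IsSolution (fun r => V (EuclideanSpace.single 0 r) - lam) W W' ∧ W 0 = 0 ∧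
      (∃ r, W r ≠ 0) ∧ IntegrableOn (fun r => W r ^ 2) (Set.Ioi 0) ∧
      ψ =ᵐ[volume] fun x => dslope W 0 ‖x‖ := by
  obtain ⟨hψ0, G, hG, heq⟩ := h
  obtain ⟨f, hψf, hwl, hw2⟩ := exists_odd_profile hG.radial hG.memLp
  have hVn : ∀ x : E3, V x = V (EuclideanSpace.single 0 ‖x‖) := fun x => hVr _ _ (by simp)
  have hVc : Continuous fun r : ℝ => V (EuclideanSpace.single 0 r) := by
    have : Continuous fun r : ℝ => V (r • EuclideanSpace.single 0 1) := by fun_prop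
    refine this.congr fun r => hVr _ _ (by simp [norm_smul])
  obtain ⟨W, W', hW, hW0, hae⟩ := exists_isSolution_of_weak
    (q := fun r => V (EuclideanSpace.single 0 r) - lam) (w := fun r => r * f |r|)
    (hVc.sub continuous_const) (fun r => by rw [hVr _ (EuclideanSpace.single 0 r) (by simp)])
    hwl (fun r => by simp) (by
      intro p hp hpc
      have hη := contDiff_comp_norm_sq hp
      have hηc := hasCompactSupport_comp_norm_sq hpc
      have h1 := heq _ _ (memH1Rad_of_contDiff hη hηc
        ⟨fun r => p (r ^ 2), by have := hp.continuous; fun_prop, ae_eq_rfl⟩)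
      rw [hG.weakGrad.integral_inner_gradient_comp_norm_sq hp hpc] at h1
      have hi1 : Integrable fun x : E3 => V x * ψ x * p (‖x‖ ^ 2) := by
        have := hG.weakGrad.1.integrable_smul_left_of_hasCompactSupport
          (hV.mul hη.continuous) (hηc.mul_left (f := V))
        refine this.congr (Eventually.of_forall fun x => ?_)
        simp only [smul_eq_mul, Pi.mul_apply]
        ring
      have hi2 : Integrable fun x : E3 => ψ x * p (‖x‖ ^ 2) := by
        simpa [mul_comm] using
          hG.weakGrad.1.integrable_smul_left_of_hasCompactSupport hη.continuous hηc
      have h2 : ∫ x, ψ x * (6 * deriv p (‖x‖ ^ 2) + 4 * ‖x‖ ^ 2 * deriv (deriv p) (‖x‖ ^ 2)) =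
          ∫ x : E3, (V x * ψ x * p (‖x‖ ^ 2) - lam * (ψ x * p (‖x‖ ^ 2))) := by
        rw [integral_sub hi1 (hi2.const_mul _), integral_const_mul]
        linarith
      have e1 : ∫ x, ψ x * (6 * deriv p (‖x‖ ^ 2) + 4 * ‖x‖ ^ 2 * deriv (deriv p) (‖x‖ ^ 2)) =
          ∫ x : E3, (fun r => f r * (6 * deriv p (r ^ 2) +
            4 * r ^ 2 * deriv (deriv p) (r ^ 2))) ‖x‖ := by
        refine integral_congr_ae ?_
        filter_upwards [hψf] with x hx
        rw [hx]
      have e2 : ∫ x : E3, (V x * ψ x * p (‖x‖ ^ 2) - lam * (ψ x * p (‖x‖ ^ 2))) =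
          ∫ x : E3, (fun r => (V (EuclideanSpace.single 0 r) - lam) * f r * p (r ^ 2)) ‖x‖ := by
        refine integral_congr_ae ?_
        filter_upwards [hψf] with x hx
        rw [hx]
        simp only [← hVn x]
        ring
      rw [e1, e2, integral_fun_norm_addHaar (volume : Measure E3) (fun r => f r *
          (6 * deriv p (r ^ 2) + 4 * r ^ 2 * deriv (deriv p) (r ^ 2))),
        integral_fun_norm_addHaar (volume : Measure E3)
          (fun r => (V (EuclideanSpace.single 0 r) - lam) * f r * p (r ^ 2))] at h2
      have hball : (volume : Measure E3).real (Metric.ball 0 1) ≠ 0 :=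
        (ENNReal.toReal_pos (Metric.measure_ball_pos _ _ one_pos).ne'
          measure_ball_lt_top.ne).ne'
      simp only [finrank_euclideanSpace, Fintype.card_fin, smul_eq_mul, nsmul_eq_mul] at h2
      have h3 := mul_left_cancel₀ hball (mul_left_cancel₀ (by norm_num) h2)
      refine Eq.trans ?_ (h3.trans ?_)
      · refine setIntegral_congr_fun measurableSet_Ioi fun r hr => ?_
        simp only [deriv_deriv_mul_comp_sq hp, abs_of_pos (Set.mem_Ioi.1 hr)]
        ring
      · refine setIntegral_congr_fun measurableSet_Ioi fun r hr => ?_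
        simp only [abs_of_pos (Set.mem_Ioi.1 hr)]
        ring)
  have hψW : ψ =ᵐ[volume] fun x => dslope W 0 ‖x‖ := by
    have hfW : ∀ᵐ r, r ∈ Set.Ioi (0 : ℝ) → f r = dslope W 0 r := by
      filter_upwards [hae] with r hr hr0
      have h0 : (0 : ℝ) < r := hr0
      have := hr hr0
      rw [abs_of_pos h0] at this
      rw [dslope_of_ne _ h0.ne', slope_def_field, hW0, ← this]
      rw [sub_zero, sub_zero, mul_div_cancel_left₀ _ h0.ne']
    filter_upwards [hψf, ae_norm_of_ae_Ioi hfW] with x hx hx'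
    rw [hx, hx']
  refine ⟨W, W', hW, hW0, ?_, ?_, hψW⟩
  · by_contra! hcon
    refine hψ0 (hψW.trans (Eventually.of_forall fun x => ?_))
    have : W = fun _ => 0 := funext hcon
    subst this
    by_cases hx : ‖x‖ = 0
    · simp [hx]
    · simp [dslope_of_ne _ hx, slope_def_field]
  · refine hw2.congr ?_
    rw [EventuallyEq, ae_restrict_iff' measurableSet_Ioi]
    filter_upwards [hae] with r hr hr0
    rw [hr hr0]

/-- The origin is never a zero: the value there is `W'(0)`, and `W(0) = W'(0) = 0` would make `W`
trivial. -/
theorem IsSolution.zeroRadii_dslope {q W W' : ℝ → ℝ} (h : IsSolution q W W') (hq : Continuous q)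
    (h0 : W 0 = 0) (hne : ∃ r, W r ≠ 0) :
    zeroRadii (fun x => dslope W 0 ‖x‖) = {r | 0 < r ∧ W r = 0} := by
  have hd : ∀ r, 0 < r → (dslope W 0 r = 0 ↔ W r = 0) := fun r hr => by
    rw [dslope_of_ne _ hr.ne', slope_def_field, h0, sub_zero, sub_zero, div_eq_zero_iff,
      or_iff_left hr.ne']
  ext r
  constructor
  · rintro ⟨x, hx, rfl⟩
    have hx' : dslope W 0 ‖x‖ = 0 := hx
    have hpos : 0 < ‖x‖ := by
      refine lt_of_le_of_ne (norm_nonneg x) fun hx0 => ?_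
      rw [← hx0, dslope_same, (h.hasDerivAt 0).deriv] at hx'
      obtain ⟨s, hs⟩ := hne
      exact hs (h.eq_zero hq h0 hx' s)
    exact ⟨hpos, (hd _ hpos).1 hx'⟩
  · rintro ⟨hr, hWr⟩
    have hnorm : ‖(EuclideanSpace.single 0 r : E3)‖ = r := by simp [abs_of_pos hr]
    refine ⟨EuclideanSpace.single 0 r, ?_, hnorm⟩
    change dslope W 0 ‖(EuclideanSpace.single 0 r : E3)‖ = 0
    rw [hnorm]
    exact (hd r hr).2 hWr

theorem IsSolution.continuous_dslope_norm {q W W' : ℝ → ℝ} (h : IsSolution q W W') :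
    Continuous fun x : E3 => dslope W 0 ‖x‖ := by
  have : Continuous (dslope W 0) := continuous_iff_continuousAt.2 fun r => by
    rcases eq_or_ne r 0 with rfl | hr
    · exact continuousAt_dslope_same.2 (h.hasDerivAt 0).differentiableAt
    · exact (continuousAt_dslope_of_ne hr).2 (h.hasDerivAt r).continuousAt
  exact this.comp continuous_norm

/-! ### Behaviour at infinity and conclusion -/

/-- The radial profile of `V` tends to zero at infinity. -/
theorem tendsto_profile_atTop {V : E3 → ℝ} {Z : ℝ}
    (h : Tendsto (fun x : E3 => ‖x‖ * V x) (cocompact E3) (𝓝 (-Z))) :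
    Tendsto (fun r : ℝ => V (EuclideanSpace.single 0 r)) atTop (𝓝 0) := by
  have h1 : Tendsto (fun r : ℝ => (EuclideanSpace.single 0 r : E3)) atTop (cocompact E3) := by
    rw [← Metric.cobounded_eq_cocompact, ← tendsto_norm_atTop_iff_cobounded]
    simpa using tendsto_abs_atTop_atTop
  have h2 := (h.comp h1).mul (tendsto_inv_atTop_zero (𝕜 := ℝ))
  rw [mul_zero] at h2
  refine h2.congr' ?_
  filter_upwards [eventually_gt_atTop 0] with r hr
  have hnorm : ‖(EuclideanSpace.single 0 r : E3)‖ = r := by simp [abs_of_pos hr]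
  simp only [Function.comp_apply, hnorm]
  field_simp

theorem exists_abs_le_of_tendsto_atTop {f : ℝ → ℝ} (hf : Continuous f) {l : ℝ}
    (h : Tendsto f atTop (𝓝 l)) (a : ℝ) : ∃ C, ∀ r, a ≤ r → |f r| ≤ C := by
  obtain ⟨R, hR⟩ := eventually_atTop.1 (h.abs.eventually (eventually_le_nhds (lt_add_one |l|)))
  obtain ⟨C, hC⟩ := (isCompact_Icc (a := a) (b := R)).exists_bound_of_continuousOn hf.continuousOn
  refine ⟨max C (|l| + 1), fun r hr => ?_⟩
  rcases le_total r R with h | h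
  · exact (hC r ⟨hr, h⟩).trans (le_max_left _ _)
  · exact (hR r h).trans (le_max_right _ _)

theorem proposition2p3 (V : E3 → ℝ) (Z : ℝ) (hZ : 0 < Z)
    (hV_smooth : ContDiff ℝ ∞ V)
    (hV_radial : ∀ x y : E3, ‖x‖ = ‖y‖ → V x = V y)
    (hV_decay : Tendsto (fun x : E3 => ‖x‖ * V x) (cocompact E3) (𝓝 (-Z))) :
    (∀ (E : ℝ) (ψ : E3 → ℝ), IsRadialEigenpair V (-E) ψ →
      ∃ u : E3 → ℝ, Continuous u ∧ u =ᵐ[volume] ψ ∧ (-E < 0 → (zeroRadii u).Finite)) ∧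
    (∀ (Em En : ℝ) (ψm ψn : E3 → ℝ),
      IsRadialEigenpair V (-Em) ψm → IsRadialEigenpair V (-En) ψn →
      Continuous ψm → Continuous ψn →
      -Em > -En → numZeros ψm ≥ numZeros ψn + 1) := by
  have hprof := tendsto_profile_atTop hV_decay
  have hVc : Continuous fun r : ℝ => V (EuclideanSpace.single 0 r) := by
    have hV := hV_smooth.continuous
    have : Continuous fun r : ℝ => V (r • EuclideanSpace.single 0 1) := by fun_prop
    exact this.congr fun r => hV_radial _ _ (by simp [norm_smul])
  have hqc : ∀ lam : ℝ, Continuous fun r : ℝ => V (EuclideanSpace.single 0 r) - lam :=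
    fun lam => hVc.sub continuous_const
  refine ⟨fun E ψ hψ => ?_, fun Em En ψm ψn hm hn hcm hcn hlt => ?_⟩
  · obtain ⟨W, W', hW, hW0, hne, -, hψW⟩ :=
      hψ.exists_isSolution hV_smooth.continuous hV_radial
    refine ⟨_, hW.continuous_dslope_norm, hψW.symm, fun hE => ?_⟩
    rw [hW.zeroRadii_dslope (hqc _) hW0 hne]
    obtain ⟨R, hR⟩ := eventually_atTop.1 (hprof.eventually (lt_mem_nhds hE))
    exact hW.finite_zeros (hqc _) hne fun r hr => sub_pos.2 (hR r hr)
  · obtain ⟨W, W', hW, hW0, hWne, hWi, hψW⟩ :=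
      hm.exists_isSolution hV_smooth.continuous hV_radial
    obtain ⟨U, U', hU, hU0, hUne, hUi, hψU⟩ :=
      hn.exists_isSolution hV_smooth.continuous hV_radial
    -- Continuous functions equal almost everywhere are equal, so the zeros may be counted on the
    -- `dslope` representatives.
    have em := (hcm.ae_eq_iff_eq volume hW.continuous_dslope_norm).1 hψW
    have en := (hcn.ae_eq_iff_eq volume hU.continuous_dslope_norm).1 hψU
    subst em en
    obtain ⟨C₁, hC₁⟩ := exists_abs_le_of_tendsto_atTop (hqc (-En))
      (hprof.sub tendsto_const_nhds) 0
    obtain ⟨C₂, hC₂⟩ := exists_abs_le_of_tendsto_atTop (hqc (-Em))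
      (hprof.sub tendsto_const_nhds) 0
    have hq : ∀ r : ℝ, V (EuclideanSpace.single 0 r) - -Em < V (EuclideanSpace.single 0 r) - -En :=
      fun r => by linarith
    rw [ge_iff_le, numZeros, numZeros, hW.zeroRadii_dslope (hqc _) hW0 hWne,
      hU.zeroRadii_dslope (hqc _) hU0 hUne]
    -- The point `0` is a zero of `U` that is not a zero radius; it plays the role of the left
    -- endpoint `a`.
    have hins : ∀ x ∈ insert 0 {r | 0 < r ∧ U r = 0}, 0 ≤ x ∧ U x = 0 := by
      rintro x (rfl | hx)
      · exact ⟨le_rfl, hU0⟩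
      · exact ⟨hx.1.le, hx.2⟩
    refine encard_add_one_le_of_interlacing (a := 0) (fun x hx => hx.1)
      (fun x hx y hy hxy => ?_) fun x hx => ?_
    · obtain ⟨c, hc, hc0⟩ := hU.exists_zero_Ioo hW hq (hqc _) hUne hxy (hins x hx).2 hy.2
      exact ⟨c, ⟨(hins x hx).1.trans_lt hc.1, hc0⟩, hc.1, hc.2⟩
    · have hx0 := (hins x hx).1
      obtain ⟨c, hc, hc0⟩ := hU.exists_zero_Ioi hW hq (hqc _) (hqc _) hUne (C := max C₁ C₂)
        (fun r hr => (hC₁ r (hx0.trans hr)).trans (le_max_left _ _))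
        (fun r hr => (hC₂ r (hx0.trans hr)).trans (le_max_right _ _))
        (hUi.mono_set (Set.Ioi_subset_Ioi hx0)) (hWi.mono_set (Set.Ioi_subset_Ioi hx0))
        (hins x hx).2
      exact ⟨c, ⟨hx0.trans_lt hc, hc0⟩, hc⟩
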